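/- Let $p$ be a prime number, let $F$ be a finite extension of $\mathbb{Q}_p$ with ring of integers $\mathcal{O}_F$, and let $E$ be a field of characteristic $p$. In $\mathrm{GL}_2(F)$ consider the subgroups \[ U=\begin{pmatrix}1&\mathcal{O}_F\\0&1\end{pmatrix},\qquad \Gamma=\begin{pmatrix}1+p\mathcal{O}_F&0\\0&1\end{pmatrix}. \] Let $E[[U]]=\varprojlim_{U'}E[U/U']$ be the Iwasawa algebra of $U$ with coefficients in $E$, where $U'$ runs over the open subgroups of $U$. It is a commutative local ring; let $\mathfrak{m}$ be its maximal ideal. The group $\Gamma$ acts on $U$ by conjugation, $u\mapsto\gamma u\gamma^{-1}$, and hence on $E[[U]]$ by $E$-algebra automorphisms. Let $M$ be a finitely generated $E[[U]]$-module equipped with a semilinear action of $\Gamma$, that is, an action of $\Gamma$ on $M$ by additive automorphisms such that $\gamma(am)=\gamma(a)\gamma(m)$ for all $\gamma\in\Gamma$, $a\in E[[U]]$, $m\in M$. Let $\mathrm{Ass}(M)$ be the set of prime ideals of $E[[U]]$ associated with $M$. Then \[ \mathrm{Ass}(M)\subset\{\{0\},\mathfrak{m}\}. \] If moreover $M$ is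 a torsion $E[[U]]$-module, then $\mathrm{Ass}(M)\subset\{\mathfrak{m}\}$ and $M$ has finite length. -/

import Mathlib

noncomputable section

/-! ### The completed group algebra of a commutative topological group -/

namespace CompletedGroupAlgebra

variable (E : Type*) [Field E] (G : Type*) [CommGroup G] [TopologicalSpace G]

/-- The transition map `E[G/N] → E[G/N']` for open subgroups `N ≤ N'`. -/
def transition {G : Type*} [CommGroup G] [TopologicalSpace G] {N N' : OpenSubgroup G}
    (h : N ≤ N') :
    MonoidAlgebra E (G ⧸ (N : Subgroup G)) →ₐ[E] MonoidAlgebra E (G ⧸ (N' : Subgroup G)) :=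
  MonoidAlgebra.mapDomainAlgHom E E
    (QuotientGroup.map (N : Subgroup G) (N' : Subgroup G) (MonoidHom.id G) h)

/-- The compatible families in the product of all `E[G/N]`, `N` an open subgroup of `G`. -/
def compatibleFamilies :
    Subalgebra E (∀ N : OpenSubgroup G, MonoidAlgebra E (G ⧸ (N : Subgroup G))) where
  carrier := {x | ∀ (N N' : OpenSubgroup G) (h : N ≤ N'), transition E h (x N) = x N'}
  mul_mem' hx hy N N' h := by simp [hx N N' h, hy N N' h]
  add_mem' hx hy N N' h := by simp [hx N N' h, hy N N' h]
  algebraMap_mem' r N N' h := by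
    simp only [Pi.algebraMap_apply, AlgHom.commutes]

end CompletedGroupAlgebra

/-- The completed group algebra (Iwasawa algebra) `E[[G]] = lim_N E[G/N]`, where `N` runs over the
open subgroups of the commutative topological group `G`. -/
def CompletedGroupAlgebra (E : Type*) [Field E] (G : Type*) [CommGroup G]
    [TopologicalSpace G] : Type _ :=
  CompletedGroupAlgebra.compatibleFamilies E G

namespace CompletedGroupAlgebra

section

variable (E : Type*) [Field E] (G : Type*) [CommGroup G] [TopologicalSpace G]

instance : CommRing (CompletedGroupAlgebra E G) :=
  inferInstanceAs (CommRing (compatibleFamilies E G))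

instance : Algebra E (CompletedGroupAlgebra E G) :=
  inferInstanceAs (Algebra E (compatibleFamilies E G))

/-- The projection `E[[G]] → E[G/N]`. -/
def proj {G : Type*} [CommGroup G] [TopologicalSpace G] (N : OpenSubgroup G) :
    CompletedGroupAlgebra E G →ₐ[E] MonoidAlgebra E (G ⧸ (N : Subgroup G)) :=
  (Pi.evalAlgHom E _ N).comp (compatibleFamilies E G).val

variable {E G}

@[ext]
theorem ext {x y : CompletedGroupAlgebra E G} (h : ∀ N, proj E N x = proj E N y) : x = y :=
  Subtype.ext (funext h)

theorem transition_proj {N N' : OpenSubgroup G} (h : N ≤ N') (x : CompletedGroupAlgebra E G) :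
    transition E h (proj E N x) = proj E N' x :=
  x.2 N N' h

/-- An element of `E[[G]]` from a compatible family. -/
def mk (x : ∀ N : OpenSubgroup G, MonoidAlgebra E (G ⧸ (N : Subgroup G)))
    (hx : ∀ (N N' : OpenSubgroup G) (h : N ≤ N'), transition E h (x N) = x N') :
    CompletedGroupAlgebra E G :=
  ⟨x, hx⟩

@[simp]
theorem proj_mk (x : ∀ N : OpenSubgroup G, MonoidAlgebra E (G ⧸ (N : Subgroup G)))
    (hx : ∀ (N N' : OpenSubgroup G) (h : N ≤ N'), transition E h (x N) = x N')
    (N : OpenSubgroup G) : proj E N (mk x hx) = x N :=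
  rfl

end

section Map

variable (E : Type*) [Field E] {G H : Type*} [CommGroup G] [TopologicalSpace G]
  [CommGroup H] [TopologicalSpace H]

/-- The map `E[G/φ⁻¹(N)] → E[H/N]` induced by a continuous homomorphism `φ : G → H`. -/
def mapLevel (φ : G →* H) (hφ : Continuous φ) (N : OpenSubgroup H) :
    MonoidAlgebra E (G ⧸ (N.comap φ hφ : Subgroup G)) →ₐ[E]
      MonoidAlgebra E (H ⧸ (N : Subgroup H)) :=
  MonoidAlgebra.mapDomainAlgHom E E
    (QuotientGroup.map (N.comap φ hφ : Subgroup G) (N : Subgroup H) φ le_rfl)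

/-- The homomorphism `E[[G]] → E[[H]]` induced by a continuous homomorphism `φ : G → H`. -/
def map (φ : G →* H) (hφ : Continuous φ) :
    CompletedGroupAlgebra E G →ₐ[E] CompletedGroupAlgebra E H :=
  AlgHom.codRestrict
    (AlgHom.pi fun N => (mapLevel E φ hφ N).comp (proj E (N.comap φ hφ)))
    (compatibleFamilies E H) (by
      intro x N N' h
      have h' : N.comap φ hφ ≤ N'.comap φ hφ := fun g hg => h hg
      have key : (transition E h).comp (mapLevel E φ hφ N) =
          (mapLevel E φ hφ N').comp (transition E h') := by
        simp only [transition, mapLevel, ← MonoidAlgebra.mapDomainAlgHom_comp]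
        congr 1
        ext g
        rfl
      have := DFunLike.congr_fun key (proj E (N.comap φ hφ) x)
      simp only [AlgHom.comp_apply, transition_proj] at this
      exact this)

theorem proj_map (φ : G →* H) (hφ : Continuous φ) (N : OpenSubgroup H)
    (x : CompletedGroupAlgebra E G) :
    proj E N (map E φ hφ x) = mapLevel E φ hφ N (proj E (N.comap φ hφ) x) :=
  rfl

theorem map_id (φ : G →* G) (hφ : Continuous φ) (h : φ = MonoidHom.id G)
    (x : CompletedGroupAlgebra E G) : map E φ hφ x = x := by
  subst h
  ext1 N
  rw [proj_map]
  exact transition_proj (le_refl N) x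

theorem map_comp {K : Type*} [CommGroup K] [TopologicalSpace K]
    (φ : G →* H) (hφ : Continuous φ) (ψ : H →* K) (hψ : Continuous ψ)
    (χ : G →* K) (hχ : Continuous χ) (h : χ = ψ.comp φ) (x : CompletedGroupAlgebra E G) :
    map E χ hχ x = map E ψ hψ (map E φ hφ x) := by
  subst h
  ext1 N
  have key : mapLevel E (ψ.comp φ) hχ N =
      (mapLevel E ψ hψ N).comp (mapLevel E φ hφ (N.comap ψ hψ)) := by
    simp only [mapLevel, ← MonoidAlgebra.mapDomainAlgHom_comp]
    congr 1
    ext g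
    rfl
  rw [proj_map, key]
  rfl

end Map

theorem continuous_toMonoidHom {Δ G : Type*} [Group Δ] [CommGroup G] [TopologicalSpace G]
    [MulDistribMulAction Δ G] [ContinuousConstSMul Δ G] (γ : Δ) :
    Continuous (MulDistribMulAction.toMonoidHom G γ) :=
  continuous_const_smul γ

/-- A group acting by continuous automorphisms on `G` acts by ring automorphisms on `E[[G]]`. -/
instance (E : Type*) [Field E] (Δ G : Type*) [Group Δ] [CommGroup G] [TopologicalSpace G]
    [MulDistribMulAction Δ G] [ContinuousConstSMul Δ G] :
    MulSemiringAction Δ (CompletedGroupAlgebra E G) where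
  smul γ := map E (MulDistribMulAction.toMonoidHom G γ) (continuous_toMonoidHom γ)
  one_smul := map_id E _ _ (by ext; simp)
  mul_smul γ δ := map_comp E _ _ _ _ _ _ (by ext; simp [mul_smul])
  smul_zero γ := map_zero _
  smul_add γ := map_add _
  smul_one γ := map_one _
  smul_mul γ := map_mul _

theorem smul_def {E : Type*} [Field E] {Δ G : Type*} [Group Δ] [CommGroup G] [TopologicalSpace G]
    [MulDistribMulAction Δ G] [ContinuousConstSMul Δ G] (γ : Δ) (x : CompletedGroupAlgebra E G) :
    γ • x = map E (MulDistribMulAction.toMonoidHom G γ) (continuous_toMonoidHom γ) x :=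
  rfl

section Local

variable (p : ℕ) [Fact p.Prime] {E : Type*} [Field E] [CharP E p]

/-- In characteristic `p`, if every element of `G` has `p`-power order, an element of `E[G]`
is nilpotent as soon as its augmentation is zero. -/
theorem isNilpotent_of_augmentation {G : Type*} [CommGroup G] (hG : ∀ g : G, ∃ k : ℕ, g ^ p ^ k = 1)
    (x : MonoidAlgebra E G) :
    IsNilpotent (x - algebraMap E _ (MonoidAlgebra.lift E E G (1 : G →* E) x)) := by
  induction x using MonoidAlgebra.induction_on with
  | of g =>
    obtain ⟨k, hk⟩ := hG g
    refine ⟨p ^ k, ?_⟩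
    have : CharP (MonoidAlgebra E G) p :=
      charP_of_injective_algebraMap (algebraMap E (MonoidAlgebra E G)).injective p
    rw [sub_pow_char_pow]
    simp only [MonoidAlgebra.lift_of, MonoidHom.one_apply, map_one, one_pow, ← map_pow, hk, sub_self]
  | add x y hx hy =>
    have := (Commute.all _ _).isNilpotent_add hx hy
    convert this using 1
    simp only [map_add]
    ring
  | smul r x hx =>
    have := (Commute.all (algebraMap E (MonoidAlgebra E G) r) _).isNilpotent_mul_left hx
    convert this using 1
    rw [map_smul, smul_eq_mul, map_mul, Algebra.smul_def]
    ring

variable {G : Type*} [CommGroup G] [TopologicalSpace G]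

variable (E G) in
/-- The augmentation `E[[G]] → E`. -/
def augmentation : CompletedGroupAlgebra E G →ₐ[E] E :=
  (MonoidAlgebra.lift E E (G ⧸ ((⊤ : OpenSubgroup G) : Subgroup G)) 1).comp (proj E ⊤)

theorem lift_one_proj (N : OpenSubgroup G) (x : CompletedGroupAlgebra E G) :
    MonoidAlgebra.lift E E (G ⧸ (N : Subgroup G)) 1 (proj E N x) = augmentation E G x := by
  have key : (MonoidAlgebra.lift E E (G ⧸ ((⊤ : OpenSubgroup G) : Subgroup G)) 1).comp
      (transition E (le_top : N ≤ ⊤)) = MonoidAlgebra.lift E E (G ⧸ (N : Subgroup G)) 1 := by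
    apply (MonoidAlgebra.lift E E (G ⧸ (N : Subgroup G))).symm.injective
    ext g
    simp [transition]
  rw [← key, AlgHom.comp_apply, transition_proj]
  rfl

theorem isUnit_of_augmentation_ne_zero (hG : ∀ (N : OpenSubgroup G) (g : G), ∃ k : ℕ, g ^ p ^ k ∈ N)
    (x : CompletedGroupAlgebra E G) (hx : augmentation E G x ≠ 0) : IsUnit x := by
  have hu : ∀ N : OpenSubgroup G, IsUnit (proj E N x) := by
    intro N
    have hn := isNilpotent_of_augmentation (E := E) p (G := G ⧸ (N : Subgroup G)) (by
      intro g
      induction g using QuotientGroup.induction_on with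
      | H g =>
        obtain ⟨k, hk⟩ := hG N g
        exact ⟨k, by rw [← QuotientGroup.mk_pow]; exact (QuotientGroup.eq_one_iff _).2 hk⟩)
      (proj E N x)
    rw [lift_one_proj] at hn
    have hc : IsUnit (algebraMap E (MonoidAlgebra E (G ⧸ (N : Subgroup G)))
        (augmentation E G x)) := (IsUnit.mk0 _ hx).map _
    have := hn.isUnit_add_left_of_commute hc (Commute.all _ _)
    simpa using this
  choose y hy using fun N => (hu N).exists_right_inv
  refine IsUnit.of_mul_eq_one (mk y ?_) ?_
  · intro N N' h
    have h1 : proj E N' x * transition E h (y N) = 1 := by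
      rw [← transition_proj h, ← map_mul, hy, map_one]
    exact (hu N').mul_left_cancel (h1.trans (hy N').symm)
  · ext1 N
    simp [hy]

/-- If `G` is pro-`p` and `E` has characteristic `p`, then `E[[G]]` is a local ring. -/
theorem isLocalRing (hG : ∀ (N : OpenSubgroup G) (g : G), ∃ k : ℕ, g ^ p ^ k ∈ N) :
    IsLocalRing (CompletedGroupAlgebra E G) := by
  have : Nontrivial (CompletedGroupAlgebra E G) := (augmentation E G).toRingHom.domain_nontrivial
  refine IsLocalRing.of_isUnit_or_isUnit_of_isUnit_add fun a b hab => ?_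
  by_contra! h
  have ha : augmentation E G a = 0 := by
    by_contra ha
    exact h.1 (isUnit_of_augmentation_ne_zero p hG a ha)
  have hb : augmentation E G b = 0 := by
    by_contra hb
    exact h.2 (isUnit_of_augmentation_ne_zero p hG b hb)
  have := (hab.map (augmentation E G)).ne_zero
  simp [ha, hb] at this

end Local

end CompletedGroupAlgebra

/-! ### The groups `U` and `Γ` -/

/-- The ring of integers `𝒪_F = {x : ‖x‖ ≤ 1}` of a nonarchimedean normed field. -/
abbrev integers (F : Type*) [NormedField F] [IsUltrametricDist F] : Subring F :=
  (NormedField.valuation (K := F)).integer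

theorem mem_integers {F : Type*} [NormedField F] [IsUltrametricDist F] {x : F} :
    x ∈ integers F ↔ ‖x‖ ≤ 1 :=
  Iff.rfl

/-- The subgroup `U` of `GL₂(F)` of matrices `(1 b; 0 1)` with `b ∈ 𝒪_F`. -/
def unipotentSubgroup (F : Type*) [NormedField F] [IsUltrametricDist F] :
    Subgroup (GL (Fin 2) F) where
  carrier := {g | ∃ b ∈ integers F, (g : Matrix (Fin 2) (Fin 2) F) = !![1, b; 0, 1]}
  one_mem' := ⟨0, zero_mem _, by simp [Matrix.one_fin_two]⟩
  mul_mem' := by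
    rintro g h ⟨b, hb, hg⟩ ⟨c, hc, hh⟩
    exact ⟨c + b, add_mem hc hb, by simp [hg, hh]⟩
  inv_mem' := by
    rintro g ⟨b, hb, hg⟩
    refine ⟨-b, neg_mem hb, ?_⟩
    rw [Matrix.coe_units_inv, hg, Matrix.inv_def]
    simp [Matrix.adjugate_fin_two, Matrix.det_fin_two]

namespace unipotentSubgroup

variable (F : Type*) [NormedField F] [IsUltrametricDist F]

instance : CommGroup (unipotentSubgroup F) :=
  { (inferInstance : Group (unipotentSubgroup F)) with
    mul_comm := by
      rintro ⟨g, b, hb, hg⟩ ⟨h, c, hc, hh⟩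
      apply Subtype.ext
      apply Units.ext
      simp [hg, hh, add_comm] }

/-- The matrix `(1 b; 0 1)`, as an element of `U`. -/
def ofInteger (b : integers F) : unipotentSubgroup F :=
  ⟨⟨!![1, (b : F); 0, 1], !![1, -(b : F); 0, 1], by simp [Matrix.one_fin_two],
    by simp [Matrix.one_fin_two]⟩, b, b.2, rfl⟩

theorem ofInteger_surjective : Function.Surjective (ofInteger F) := by
  rintro ⟨g, b, hb, hg⟩
  exact ⟨⟨b, hb⟩, Subtype.ext (Units.ext hg.symm)⟩

theorem ofInteger_zero : ofInteger F 0 = 1 :=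
  Subtype.ext (Units.ext (by simp [ofInteger, Matrix.one_fin_two]))

theorem ofInteger_add (b c : integers F) : ofInteger F (b + c) = ofInteger F b * ofInteger F c :=
  Subtype.ext (Units.ext (by simp [ofInteger, add_comm]))

theorem ofInteger_nsmul (n : ℕ) (b : integers F) : ofInteger F (n • b) = ofInteger F b ^ n := by
  induction n with
  | zero => simp [ofInteger_zero]
  | succ n ih => rw [succ_nsmul, pow_succ, ofInteger_add, ih]

theorem continuous_ofInteger : Continuous (ofInteger F) := by
  refine Continuous.subtype_mk (Units.continuous_iff.2 ⟨?_, ?_⟩) _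
  · refine continuous_matrix fun i j => ?_
    fin_cases i <;> fin_cases j <;> simp <;> fun_prop
  · refine continuous_matrix fun i j => ?_
    fin_cases i <;> fin_cases j <;> simp <;> fun_prop

end unipotentSubgroup

theorem norm_natCast_prime (p : ℕ) [Fact p.Prime] (F : Type*) [NormedField F]
    [NormedAlgebra ℚ_[p] F] : ‖(p : F)‖ = (p : ℝ)⁻¹ := by
  have h := norm_algebraMap' F (p : ℚ_[p])
  rwa [map_natCast, Padic.norm_p] at h

section Gamma

variable (p : ℕ) [Fact p.Prime] (F : Type*) [NormedField F] [NormedAlgebra ℚ_[p] F]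
  [IsUltrametricDist F]

theorem norm_one_add_prime_mul {a : F} (ha : a ∈ integers F) : ‖1 + (p : F) * a‖ = 1 := by
  have h1 : ‖(p : F) * a‖ < 1 := by
    rw [norm_mul, norm_natCast_prime p F]
    have hp : ((p : ℝ))⁻¹ < 1 :=
      inv_lt_one_of_one_lt₀ (by exact_mod_cast (Fact.out : p.Prime).one_lt)
    have ha' : ‖a‖ ≤ 1 := mem_integers.1 ha
    have h0 : (0 : ℝ) ≤ (p : ℝ)⁻¹ := by positivity
    nlinarith [norm_nonneg a]
  rw [IsUltrametricDist.norm_add_eq_max_of_norm_ne_norm (by rw [norm_one]; exact h1.ne'), norm_one,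
    max_eq_left h1.le]

/-- The subgroup `Γ` of `GL₂(F)` of matrices `(1 + p a 0; 0 1)` with `a ∈ 𝒪_F`. -/
def gammaSubgroup : Subgroup (GL (Fin 2) F) where
  carrier := {g | ∃ a ∈ integers F, (g : Matrix (Fin 2) (Fin 2) F) = !![1 + (p : F) * a, 0; 0, 1]}
  one_mem' := ⟨0, zero_mem _, by simp [Matrix.one_fin_two]⟩
  mul_mem' := by
    rintro g h ⟨a, ha, hg⟩ ⟨c, hc, hh⟩
    refine ⟨a + c + (p : F) * a * c, ?_, ?_⟩
    · exact add_mem (add_mem ha hc) (mul_mem (mul_mem (natCast_mem _ p) ha) hc)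
    · simp only [Units.val_mul, hg, hh, Matrix.mul_fin_two]
      congr! 3 <;> ring_nf
  inv_mem' := by
    rintro g ⟨a, ha, hg⟩
    have hn := norm_one_add_prime_mul p F ha
    have h0 : 1 + (p : F) * a ≠ 0 := by
      intro h
      rw [h, norm_zero] at hn
      exact zero_ne_one hn
    refine ⟨-a * (1 + (p : F) * a)⁻¹, ?_, ?_⟩
    · refine mul_mem (neg_mem ha) (mem_integers.2 ?_)
      rw [norm_inv, hn, inv_one]
    · rw [Matrix.coe_units_inv, hg]
      apply Matrix.inv_eq_left_inv
      ext i j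
      fin_cases i <;> fin_cases j <;> simp
      field_simp
      ring

theorem gammaSubgroup_conj_mem (γ : gammaSubgroup p F) (u : unipotentSubgroup F) :
    (γ : GL (Fin 2) F) * u * (γ : GL (Fin 2) F)⁻¹ ∈ unipotentSubgroup F := by
  obtain ⟨γ, a, ha, hγ⟩ := γ
  obtain ⟨u, b, hb, hu⟩ := u
  refine ⟨(1 + (p : F) * a) * b,
    mul_mem (add_mem (one_mem _) (mul_mem (natCast_mem _ p) ha)) hb, ?_⟩
  have hw : IsUnit ((γ : Matrix (Fin 2) (Fin 2) F)) := γ.isUnit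
  rw [Units.val_mul, Units.mul_inv_eq_iff_eq_mul, Units.val_mul, hγ, hu]
  simp

/-- `Γ` acts on `U` by conjugation: `γ • u = γ u γ⁻¹`. -/
instance : MulDistribMulAction (gammaSubgroup p F) (unipotentSubgroup F) where
  smul γ u := ⟨(γ : GL (Fin 2) F) * u * (γ : GL (Fin 2) F)⁻¹, gammaSubgroup_conj_mem p F γ u⟩
  one_smul u := Subtype.ext (show (1 : GL (Fin 2) F) * u * (1 : GL (Fin 2) F)⁻¹ = u by simp)
  mul_smul γ δ u := Subtype.ext (show (γ * δ : GL (Fin 2) F) * u * (γ * δ : GL (Fin 2) F)⁻¹ =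
    γ * (δ * u * (δ : GL (Fin 2) F)⁻¹) * (γ : GL (Fin 2) F)⁻¹ by group)
  smul_mul γ u v := Subtype.ext (show (γ : GL (Fin 2) F) * (u * v) * (γ : GL (Fin 2) F)⁻¹ =
    γ * u * (γ : GL (Fin 2) F)⁻¹ * (γ * v * (γ : GL (Fin 2) F)⁻¹) by group)
  smul_one γ := Subtype.ext (show (γ : GL (Fin 2) F) * 1 * (γ : GL (Fin 2) F)⁻¹ = 1 by simp)

theorem gammaSubgroup_coe_smul (γ : gammaSubgroup p F) (u : unipotentSubgroup F) :
    ((γ • u : unipotentSubgroup F) : GL (Fin 2) F) = γ * u * (γ : GL (Fin 2) F)⁻¹ :=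
  rfl

instance : ContinuousConstSMul (gammaSubgroup p F) (unipotentSubgroup F) where
  continuous_const_smul γ :=
    ((continuous_const.mul continuous_subtype_val).mul continuous_const).subtype_mk _

/-- `U` is a pro-`p` group. -/
theorem unipotentSubgroup_pow_mem (N : OpenSubgroup (unipotentSubgroup F))
    (u : unipotentSubgroup F) : ∃ k : ℕ, u ^ p ^ k ∈ N := by
  obtain ⟨⟨b, hb⟩, rfl⟩ := unipotentSubgroup.ofInteger_surjective F u
  have hlim : Filter.Tendsto (fun k : ℕ => (p ^ k • (⟨b, hb⟩ : integers F))) Filter.atTop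
      (nhds 0) := by
    rw [tendsto_subtype_rng]
    have h1 : Filter.Tendsto (fun k : ℕ => (p : F) ^ k) Filter.atTop (nhds 0) := by
      apply tendsto_pow_atTop_nhds_zero_of_norm_lt_one
      rw [norm_natCast_prime p F]
      exact inv_lt_one_of_one_lt₀ (by exact_mod_cast (Fact.out : p.Prime).one_lt)
    simpa using h1.mul_const b
  have hU := ((unipotentSubgroup.continuous_ofInteger F).tendsto 0).comp hlim
  rw [unipotentSubgroup.ofInteger_zero] at hU
  obtain ⟨k, hk⟩ := (hU.eventually (N.isOpen.mem_nhds N.one_mem)).exists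
  refine ⟨k, ?_⟩
  rw [Function.comp_apply, unipotentSubgroup.ofInteger_nsmul] at hk
  exact hk

/-- The Iwasawa algebra `E[[U]]` is a local ring. -/
theorem iwasawaAlgebra_isLocalRing (E : Type*) [Field E] [CharP E p] :
    IsLocalRing (CompletedGroupAlgebra E (unipotentSubgroup F)) :=
  CompletedGroupAlgebra.isLocalRing p (unipotentSubgroup_pow_mem p F)

/-- The maximal ideal `𝔪` of the local ring `E[[U]]`. -/
def iwasawaMaximalIdeal (E : Type*) [Field E] [CharP E p] :
    Ideal (CompletedGroupAlgebra E (unipotentSubgroup F)) :=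
  haveI := iwasawaAlgebra_isLocalRing p F E
  IsLocalRing.maximalIdeal (CompletedGroupAlgebra E (unipotentSubgroup F))

end Gamma

end

/-! `E[[U]]` is Noetherian, a quotient of a power series ring in finitely many variables, so `M` has
finitely many associated primes. `Γ` permutes them, hence for some `r ≠ 0` every `γ ^ r` fixes each
of them. It remains to see that a prime `P` stable under all `γ ^ r` is `0` or `𝔪`; the torsion case
then follows formally.

Let `L` be the group of `b ∈ 𝒪_F` whose unipotent element is trivial modulo `P`. It is stable under
multiplication by all `(1 + p a) ^ r`, and `n b ∈ L` with `n ≠ 0` forces `b ∈ L`. Taking finite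
differences of `X ^ r` shows that `L` is an ideal of `𝒪_F`; since it is closed under division by
`p`, it is `0` or `𝒪_F` (`faithful_or_trivial`). If `L = 𝒪_F` then `P = 𝔪`.

If `L = 0`, then `P = 0` (`eq_bot_of_faithful`). The quotient by `P` carries a valuation `v`, at
most `α < 1` on the maximal ideal and bounded below by a power of `α` at each nonzero element
(`IsLocalRing.exists_valuation`). By compactness the subgroups `V = {g : v (g - 1) ≤ t}`, `t` a
power of `α`, shrink to `1`. By Hensel's lemma, `P` is stable under `Φ m : g ↦ g ^ (1 + q m)` for
some `q = p ^ K`. Let `w` run over representatives of the nontrivial cosets of `V`, and combine the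
`Φ m` with the coefficients of `∏ (X - w ^ q)`. The resulting operator `T` satisfies `T g = g (∏ (g
- w)) ^ q`, because the characteristic is `p`. With `D = ∏ (1 - w)`, `T g` is `D ^ q` up to smaller
terms when `g ∈ V`, and smaller than `D ^ q` otherwise. So for `f ∈ P`, whose image `T f` has
valuation `0`, the coefficient of `f` at the coset `V` vanishes (`coeff_proj_eq_zero`). Applied to
all `g⁻¹ f` and all small `V`, this gives `f = 0`. -/

/-! ### Valuations on Noetherian local domains. -/

section Valuation

open IsLocalRing

universe u

/-- Every prime of a subring of a field is the center of a valuation. -/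
theorem Subring.exists_valuationSubring_center {K : Type*} [Field K] (B : Subring K) (q : Ideal B)
    [q.IsPrime] :
    ∃ V : ValuationSubring K, (∀ b : B, V.valuation (b : K) ≤ 1) ∧
      ∀ b : B, V.valuation (b : K) < 1 ↔ b ∈ q := by
  obtain ⟨V, hle, hloc⟩ := (LocalSubring.ofPrime B q).exists_le_valuationSubring
  have hB : ∀ b : B, (b : K) ∈ V := fun b => hle (LocalSubring.le_ofPrime B q b.2)
  refine ⟨V, fun b => (V.valuation_le_one_iff _).2 (hB b), fun b => ?_⟩
  have h1 := V.valuation_lt_one_iff ⟨b, hB b⟩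
  have h2 : IsUnit (⟨b, hB b⟩ : V) ↔ b ∉ q := by
    refine Iff.trans ?_
      (IsLocalization.AtPrime.isUnit_to_map_iff (LocalSubring.ofPrime B q).toSubring q b)
    exact ⟨fun h => hloc.map_nonunit _ h, fun h => h.map (Subring.inclusion hle)⟩
  rw [← not_iff_not, ← h2, ← not_iff_not.2 h1, mem_maximalIdeal, mem_nonunits_iff, not_not]

/-- If `q` is a prime of height at most one of a domain `B`, `a ∈ q` and `b ≠ 0`, then `b` divides
`a ^ n * s` for some `n` and some `s ∉ q`. -/
theorem Ideal.exists_dvd_pow_mul_of_height_le_one {B : Type*} [CommRing B] [IsDomain B]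
    (q : Ideal B) [q.IsPrime] (hq : q.height ≤ 1) {a b : B} (ha : a ∈ q) (hb : b ≠ 0) :
    ∃ n : ℕ, ∃ s ∉ q, b ∣ a ^ n * s := by
  by_contra! hcon
  -- A prime containing `b` and avoiding both `a` and the complement of `q` would give a chain `0 <
  -- P < q`, which the height bound forbids.
  obtain ⟨P, hP, hbP, hdis⟩ := Ideal.exists_le_prime_disjoint (I := Ideal.span {b})
    (Submonoid.powers a ⊔ q.primeCompl) (by
      rw [Set.disjoint_left]
      intro x hx hx'
      obtain ⟨y, ⟨n, rfl⟩, s, hs, rfl⟩ := Submonoid.mem_sup.1 hx'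
      exact hcon n s hs (Ideal.mem_span_singleton.1 hx))
  rw [Set.disjoint_left] at hdis
  have hPq : P < q := by
    refine lt_of_le_of_ne (fun x hx => ?_) ?_
    · by_contra hxq
      exact hdis hx (Submonoid.mem_sup_right hxq)
    · rintro rfl
      exact hdis ha (Submonoid.mem_sup_left (Submonoid.mem_powers a))
  have h0 : (⊥ : Ideal B) < P := by
    rw [bot_lt_iff_ne_bot]
    rintro rfl
    exact hb (by simpa using hbP)
  have : q.FiniteHeight := ⟨Or.inr (lt_of_le_of_lt hq (by simp)).ne⟩
  have : P.FiniteHeight := Ideal.finiteHeight_of_le hPq.le (Ideal.IsPrime.ne_top inferInstance)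
  have : (⊥ : Ideal B).FiniteHeight := Ideal.finiteHeight_of_le h0.le hP.ne_top
  have h1 := Ideal.height_strict_mono_of_isPrime h0
  have h2 := Ideal.height_strict_mono_of_isPrime hPq
  have h3 := lt_of_lt_of_le h2 hq
  rw [Order.lt_one_iff] at h3
  rw [h3] at h1
  exact not_lt_bot h1

/-- A Noetherian local domain that is not a field carries a valuation, positive on the maximal
ideal, whose topology is Hausdorff. -/
theorem IsLocalRing.exists_valuation (A : Type u) [CommRing A] [IsDomain A] [IsNoetherianRing A]
    [IsLocalRing A] (hA : maximalIdeal A ≠ ⊥) :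
    ∃ (Γ₀ : Type u) (_ : LinearOrderedCommGroupWithZero Γ₀) (v : Valuation A Γ₀) (α : Γ₀),
      (∀ x, v x ≤ 1) ∧ α < 1 ∧ (∀ x ∈ maximalIdeal A, v x ≤ α) ∧
        ∀ x, x ≠ 0 → v x ≠ 0 ∧ ∃ n : ℕ, α ^ n ≤ v x := by
  classical
  let K := FractionRing A
  have hinj : Function.Injective (algebraMap A K) := IsFractionRing.injective A K
  -- a valuation ring dominating `A`
  obtain ⟨V₀, hV₀, hV₀m⟩ : ∃ V : ValuationSubring K, (∀ x : A, V.valuation (algebraMap A K x) ≤ 1) ∧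
      ∀ x ∈ maximalIdeal A, V.valuation (algebraMap A K x) < 1 := by
    let e : A ≃+* (algebraMap A K).range := RingEquiv.ofBijective (algebraMap A K).rangeRestrict
      ⟨fun x y h => hinj (congrArg Subtype.val h), (algebraMap A K).rangeRestrict_surjective⟩
    have : ((maximalIdeal A).comap (e.symm : (algebraMap A K).range →+* A)).IsPrime :=
      Ideal.comap_isPrime _ _
    obtain ⟨V, h1, h2⟩ := Subring.exists_valuationSubring_center (algebraMap A K).range
      ((maximalIdeal A).comap (e.symm : (algebraMap A K).range →+* A))
    refine ⟨V, fun x => h1 (e x), fun x hx => (h2 (e x)).2 ?_⟩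
    simpa using hx
  obtain ⟨s, hs⟩ := IsNoetherian.noetherian (maximalIdeal A)
  have hsne : s.Nonempty := by
    rw [Finset.nonempty_iff_ne_empty]
    rintro rfl
    exact hA (by simpa using hs.symm)
  -- Choosing `a` of largest value puts every `x / a` in `V₀`. Hence the chart below lies in `V₀`,
  -- and `a` remains a nonunit there.
  obtain ⟨a, has, hamax⟩ := s.exists_max_image (fun x => V₀.valuation (algebraMap A K x)) hsne
  have ham : a ∈ maximalIdeal A := hs ▸ Ideal.subset_span has
  have ha0 : algebraMap A K a ≠ 0 := by
    intro h0
    apply hA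
    rw [← hs]
    refine Ideal.span_eq_bot.2 fun x hx => ?_
    have := hamax x hx
    rw [h0, map_zero, le_zero_iff, Valuation.zero_iff] at this
    exact hinj (by simpa using this)
  -- the chart `B = A[𝔪/a]` of the blow-up
  let C : Subalgebra A K := Algebra.adjoin A (s.image fun x => algebraMap A K x / algebraMap A K a)
  have : Algebra.FiniteType A C :=
    (Subalgebra.fg_iff_finiteType _).1 (Subalgebra.fg_adjoin_finset _)
  have hC : IsNoetherianRing C :=
    Algebra.FiniteType.isNoetherianRing A C
  let B : Subring K := C.toSubring
  have hB : IsNoetherianRing B := hC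
  have hCV : ∀ b : B, V₀.valuation (b : K) ≤ 1 := by
    intro b
    rw [V₀.valuation_le_one_iff]
    refine Algebra.adjoin_induction (p := fun x _ => x ∈ V₀) ?_ ?_ ?_ ?_ b.2
    · intro x hx
      simp only [Finset.coe_image, Set.mem_image, Finset.mem_coe] at hx
      obtain ⟨y, hy, rfl⟩ := hx
      rw [← V₀.valuation_le_one_iff, map_div₀]
      exact div_le_one_of_le₀ (hamax y hy) zero_le
    · intro r
      exact (V₀.valuation_le_one_iff _).1 (hV₀ r)
    · intro x y _ _ hx hy
      exact V₀.add_mem _ _ hx hy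
    · intro x y _ _ hx hy
      exact V₀.mul_mem _ _ hx hy
  let aB : B := ⟨algebraMap A K a, C.algebraMap_mem a⟩
  have htop : Ideal.span {aB} ≠ ⊤ := by
    intro h
    rw [Ideal.span_singleton_eq_top] at h
    obtain ⟨c, hc⟩ := h.exists_right_inv
    have h1 : V₀.valuation (algebraMap A K a) * V₀.valuation (c : K) = 1 := by
      rw [← map_mul, ← map_one V₀.valuation]
      exact congrArg (fun z : B => V₀.valuation (z : K)) hc
    exact absurd h1 (mul_lt_one_of_nonneg_of_lt_one_left zero_le (hV₀m a ham) (hCV c)).ne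
  obtain ⟨Q, hQ, hQle⟩ := Ideal.exists_le_maximal _ htop
  have := hQ.isPrime
  -- Krull's principal ideal theorem gives `q` height at most one. In the chart `𝔪` becomes
  -- divisible by `a`, so a valuation centred at `q` is at most `v a < 1` on `𝔪`.
  obtain ⟨q, hqmin, -⟩ := Ideal.exists_minimalPrimes_le hQle
  have hqp : q.IsPrime := hqmin.1.1
  have haq : aB ∈ q := hqmin.1.2 (Ideal.mem_span_singleton_self aB)
  have : (Ideal.span {aB}).IsPrincipal := ⟨aB, rfl⟩
  have hqh : q.height ≤ 1 := Ideal.height_le_one_of_isPrincipal_of_mem_minimalPrimes _ q hqmin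
  obtain ⟨V, hV1, hV2⟩ := Subring.exists_valuationSubring_center B q
  have hVA : ∀ x : A, V.valuation (algebraMap A K x) ≤ 1 :=
    fun x => hV1 ⟨_, C.algebraMap_mem x⟩
  refine ⟨V.ValueGroup, inferInstance, V.valuation.comap (algebraMap A K),
    V.valuation (algebraMap A K a), hVA, (hV2 aB).2 haq, fun x hx => ?_, fun x hx => ?_⟩
  · rw [← hs] at hx
    refine Submodule.span_induction ?_ ?_ ?_ ?_ hx
    · intro y hy
      have h2 := hV1 ⟨algebraMap A K y / algebraMap A K a,
        Algebra.subset_adjoin (by simpa using ⟨y, hy, rfl⟩)⟩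
      simp only [map_div₀] at h2
      exact (div_le_one₀ (zero_lt_iff.2 (by simpa using ha0))).1 h2
    · simp
    · intro y z _ _ hy hz
      exact (Valuation.map_add _ _ _).trans (max_le hy hz)
    · intro r y _ hy
      rw [smul_eq_mul, map_mul]
      exact (mul_le_of_le_one_left zero_le (hVA r)).trans hy
  · have hx0 : algebraMap A K x ≠ 0 := by simpa using hx
    refine ⟨by simpa using hx, ?_⟩
    -- From `a ^ n * t = x * c` with `t` of value `1` and `c` of value at most `1`, the lower bound
    -- `v a ^ n ≤ v x` follows.
    obtain ⟨n, t, ht, c, hc⟩ := q.exists_dvd_pow_mul_of_height_le_one hqh haq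
      (b := ⟨algebraMap A K x, C.algebraMap_mem x⟩) (fun h => hx0 (congrArg Subtype.val h))
    refine ⟨n, ?_⟩
    have ht1 : V.valuation (t : K) = 1 :=
      le_antisymm (hV1 t) (not_lt.1 fun h => ht ((hV2 t).1 h))
    have h3 := congrArg (fun z : B => V.valuation (z : K)) hc
    simp only [Subring.coe_mul, map_mul, ht1, mul_one, SubmonoidClass.coe_pow, map_pow] at h3
    rw [Valuation.comap_apply]
    calc _ = _ := h3
      _ ≤ _ := mul_le_of_le_one_right zero_le (hV1 c)

end Valuation

/-! ### Evaluation of power series at nilpotents, and kernels between group algebras. -/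

noncomputable section

namespace MvPowerSeries

variable {σ E T T' : Type*} [Finite σ] [CommRing E] [CommRing T] [Algebra E T] [CommRing T']
  [Algebra E T']

theorem hasEval_of_isNilpotent {σ T : Type*} [Finite σ] [CommRing T] [TopologicalSpace T]
    {a : σ → T} (ha : ∀ i, IsNilpotent (a i)) : HasEval a where
  hpow i := by
    obtain ⟨n, hn⟩ := ha i
    exact tendsto_atTop_of_eventually_const (i₀ := n) fun k hk => pow_eq_zero_of_le hk hn
  tendsto_zero := by simp

theorem continuousSMul_of_discreteUniformity [UniformSpace E] [DiscreteUniformity E]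
    [UniformSpace T] [DiscreteUniformity T] : ContinuousSMul E T :=
  ⟨continuous_of_discreteTopology⟩

/-- Evaluation of power series at nilpotent elements. -/
def nilpotentEval (a : σ → T) (ha : ∀ i, IsNilpotent (a i)) : MvPowerSeries σ E →ₐ[E] T :=
  -- For discrete topologies nilpotent means topologically nilpotent, so the topological evaluation
  -- applies.
  letI : UniformSpace E := ⊥
  letI : UniformSpace T := ⊥
  haveI : DiscreteUniformity E := ⟨rfl⟩
  haveI : DiscreteUniformity T := ⟨rfl⟩
  haveI : ContinuousSMul E T := continuousSMul_of_discreteUniformity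
  aeval (hasEval_of_isNilpotent ha)

theorem nilpotentEval_X (a : σ → T) (ha : ∀ i, IsNilpotent (a i)) (i : σ) :
    nilpotentEval (E := E) a ha (X i) = a i := by
  let _ : UniformSpace E := ⊥
  let _ : UniformSpace T := ⊥
  have : DiscreteUniformity E := ⟨rfl⟩
  have : DiscreteUniformity T := ⟨rfl⟩
  have : ContinuousSMul E T := continuousSMul_of_discreteUniformity
  have := aeval_coe (R := E) (hasEval_of_isNilpotent ha) (MvPolynomial.X i)
  rw [MvPolynomial.coe_X, MvPolynomial.aeval_X] at this
  exact this

theorem map_nilpotentEval (a : σ → T) (ha : ∀ i, IsNilpotent (a i)) (f : T →ₐ[E] T')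
    (b : σ → T') (hb : ∀ i, IsNilpotent (b i)) (h : ∀ i, f (a i) = b i) (x : MvPowerSeries σ E) :
    f (nilpotentEval a ha x) = nilpotentEval b hb x := by
  let _ : UniformSpace E := ⊥
  let _ : UniformSpace T := ⊥
  let _ : UniformSpace T' := ⊥
  have : DiscreteUniformity E := ⟨rfl⟩
  have : DiscreteUniformity T := ⟨rfl⟩
  have : DiscreteUniformity T' := ⟨rfl⟩
  have : ContinuousSMul E T := continuousSMul_of_discreteUniformity
  have : ContinuousSMul E T' := continuousSMul_of_discreteUniformity
  obtain rfl : f ∘ a = b := funext h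
  have := comp_aeval (R := E) (hasEval_of_isNilpotent ha) (ε := f)
    continuous_of_discreteTopology
  exact DFunLike.congr_fun this x

end MvPowerSeries

/-- The kernel of `E[G] → E[H]` is generated by the `g - 1`, `g` in a set of generators of the
kernel of `G → H`. -/
theorem MonoidAlgebra.mem_span_of_mapDomainAlgHom_eq_zero {E G H : Type*} [CommRing E] [CommGroup G]
    [CommGroup H] (f : G →* H) {s : Set G} (hs : f.ker ≤ Subgroup.closure s)
    {x : MonoidAlgebra E G} (hx : MonoidAlgebra.mapDomainAlgHom E E f x = 0) :
    x ∈ Ideal.span ((fun g => MonoidAlgebra.of E G g - 1) '' s) := by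
  classical
  set I := Ideal.span ((fun g => MonoidAlgebra.of E G g - 1) '' s) with hI
  let q : G →* MonoidAlgebra E G ⧸ I :=
    ((Ideal.Quotient.mk I : MonoidAlgebra E G →+* _) : MonoidAlgebra E G →* _).comp
      (MonoidAlgebra.of E G)
  have hq : ∀ g ∈ f.ker, q g = 1 := by
    intro g hg
    have hle : Subgroup.closure s ≤ q.ker := by
      rw [Subgroup.closure_le]
      intro g hg
      change Ideal.Quotient.mk I (MonoidAlgebra.of E G g) = 1
      rw [← map_one (Ideal.Quotient.mk I), Ideal.Quotient.eq]
      exact Ideal.subset_span ⟨g, hg, rfl⟩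
    exact hle (hs hg)
  have hqf : ∀ g g', f g = f g' → q g = q g' := by
    intro g g' h
    have h1 := hq (g * g'⁻¹) (by simp [MonoidHom.mem_ker, h])
    have h2 : g = g * g'⁻¹ * g' := by group
    rw [h2, map_mul, h1, one_mul]
  -- a linear section through the quotient
  let σ : MonoidAlgebra E H →ₗ[E] MonoidAlgebra E G ⧸ I :=
    Finsupp.lsum E (fun h => (LinearMap.toSpanSingleton E _
      -- The value outside the image of `f` plays no role; on the image, the choice of preimage is
      -- harmless by `hqf`.
      (if hh : ∃ g, f g = h then q hh.choose else 0))) ∘ₗ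
        (MonoidAlgebra.coeffLinearEquiv E).toLinearMap
  have key : ∀ y : MonoidAlgebra E G,
      σ (MonoidAlgebra.mapDomainAlgHom E E f y) = Ideal.Quotient.mk I y := by
    intro y
    induction y using MonoidAlgebra.induction_on with
    | of g =>
      have h : ∃ g', f g' = f g := ⟨g, rfl⟩
      simp only [σ, MonoidAlgebra.mapDomainAlgHom_apply, MonoidAlgebra.of_apply,
        MonoidAlgebra.mapDomain_single, LinearMap.comp_apply, LinearEquiv.coe_coe,
        MonoidAlgebra.coeffLinearEquiv_apply, MonoidAlgebra.coeff_single, Finsupp.lsum_single,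
        LinearMap.toSpanSingleton_apply, one_smul, dif_pos h]
      exact hqf _ _ h.choose_spec
    | add y z hy hz => rw [map_add, map_add, map_add, hy, hz]
    | smul r y hy =>
      rw [map_smul, map_smul, hy]
      exact (map_smul (Ideal.Quotient.mkₐ E I) r y).symm
  rw [← Ideal.Quotient.eq_zero_iff_mem, ← key, hx, map_zero]

theorem Ideal.exists_pow_map_eq_zero {A B ι : Type*} [CommRing A] [CommRing B] [Finite ι]
    (f : A →+* B) (t : ι → A) (h : ∀ i, IsNilpotent (f (t i))) :
    ∃ k : ℕ, ∀ x ∈ Ideal.span (Set.range t) ^ k, f x = 0 := by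
  classical
  have := Fintype.ofFinite ι
  have hfg : ((Ideal.span (Set.range t)).map f).FG :=
    Ideal.FG.map ⟨Finset.univ.image t, by simp [Ideal.span]⟩ f
  obtain ⟨k, hk⟩ := hfg.isNilpotent_iff_le_nilradical.2 (by
    rw [Ideal.map_span, Ideal.span_le]
    rintro _ ⟨_, ⟨i, rfl⟩, rfl⟩
    exact h i)
  refine ⟨k, fun x hx => ?_⟩
  have := Ideal.mem_map_of_mem f hx
  rw [Ideal.map_pow, hk] at this
  simpa using this

/-! ### Topological generators and the Noetherian property of `E[[G]]`. -/

namespace CompletedGroupAlgebra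

section

variable {E : Type*} [Field E] {G : Type*} [CommGroup G] [TopologicalSpace G]

variable (E) in
/-- The group element `g`, as an element of `E[[G]]`. -/
def of : G →* CompletedGroupAlgebra E G where
  toFun g := mk (fun _ => MonoidAlgebra.of E _ (g : G ⧸ _)) (by
    intro N N' h
    simp only [transition, MonoidAlgebra.mapDomainAlgHom_apply, MonoidAlgebra.of_apply,
      MonoidAlgebra.mapDomain_single]
    rfl)
  map_one' := by
    ext1 N
    simp
    rfl
  map_mul' g h := by
    ext1 N
    simp

@[simp]
theorem proj_of (N : OpenSubgroup G) (g : G) :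
    proj E N (of E g) = MonoidAlgebra.of E (G ⧸ (N : Subgroup G)) (g : G ⧸ (N : Subgroup G)) :=
  rfl

theorem map_of {H : Type*} [CommGroup H] [TopologicalSpace H] (φ : G →* H) (hφ : Continuous φ)
    (g : G) : map E φ hφ (of E g) = of E (φ g) := by
  ext1 N
  rw [proj_map, proj_of, proj_of, mapLevel, MonoidAlgebra.mapDomainAlgHom_apply,
    MonoidAlgebra.of_apply, MonoidAlgebra.mapDomain_single]
  rfl

@[simp]
theorem augmentation_of (g : G) : augmentation E G (of E g) = 1 := by
  rw [augmentation, AlgHom.comp_apply, proj_of, MonoidAlgebra.lift_of, MonoidHom.one_apply]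

/-- Every element of `E[G/N]` lifts to a linear combination of group elements. -/
theorem exists_mem_span_proj_eq (N : OpenSubgroup G) (x : MonoidAlgebra E (G ⧸ (N : Subgroup G))) :
    ∃ y ∈ Submodule.span E (Set.range (of E (G := G))), proj E N y = x := by
  induction x using MonoidAlgebra.induction_on with
  | of g =>
    obtain ⟨g, rfl⟩ := QuotientGroup.mk_surjective g
    exact ⟨of E g, Submodule.subset_span ⟨g, rfl⟩, rfl⟩
  | add x y hx hy =>
    obtain ⟨a, ha, rfl⟩ := hx
    obtain ⟨b, hb, rfl⟩ := hy
    exact ⟨a + b, add_mem ha hb, map_add _ _ _⟩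
  | smul r x hx =>
    obtain ⟨a, ha, rfl⟩ := hx
    exact ⟨r • a, Submodule.smul_mem _ r ha, map_smul _ _ _⟩

theorem proj_surjective (N : OpenSubgroup G) : Function.Surjective (proj E (G := G) N) := by
  intro x
  obtain ⟨y, -, h⟩ := exists_mem_span_proj_eq N x
  exact ⟨y, h⟩

theorem proj_eq_zero_of_le {N N' : OpenSubgroup G} (h : N ≤ N') {x : CompletedGroupAlgebra E G}
    (hx : proj E N x = 0) : proj E N' x = 0 := by
  rw [← transition_proj h, hx, map_zero]

theorem proj_eq_zero_of_augmentation_eq_zero {N : OpenSubgroup G} (hN : N = ⊤)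
    {x : CompletedGroupAlgebra E G} (hx : augmentation E G x = 0) : proj E N x = 0 := by
  have key : ∀ y : MonoidAlgebra E (G ⧸ (N : Subgroup G)),
      y = algebraMap E _ (MonoidAlgebra.lift E E (G ⧸ (N : Subgroup G)) 1 y) := by
    intro y
    induction y using MonoidAlgebra.induction_on with
    | of g =>
      obtain ⟨g, rfl⟩ := QuotientGroup.mk_surjective g
      have hg : (g : G ⧸ (N : Subgroup G)) = 1 := by
        rw [QuotientGroup.eq_one_iff, hN]
        exact Subgroup.mem_top g
      rw [hg, map_one, map_one, map_one]
    | add y z hy hz => rw [map_add, map_add, ← hy, ← hz]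
    | smul r y hy => rw [map_smul, smul_eq_mul, map_mul, ← hy, Algebra.smul_def]
  rw [key (proj E N x), lift_one_proj, hx, map_zero]

/-- `E[[G]]` is complete for the filtration by the kernels of `E[[G]] → E[G/W n]`. -/
theorem exists_limit {W : ℕ → OpenSubgroup G} (hW : Antitone W) (hcof : ∀ N, ∃ n, W n ≤ N)
    (y : ℕ → CompletedGroupAlgebra E G) (hy : ∀ n, proj E (W n) (y (n + 1) - y n) = 0) :
    ∃ l, ∀ n, proj E (W n) (l - y n) = 0 := by
  have hle : ∀ N n, W n ≤ N → ∀ m, n ≤ m → proj E N (y m) = proj E N (y n) := by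
    intro N n hn m hm
    induction m, hm using Nat.le_induction with
    | base => rfl
    | succ m hm ih =>
      rw [← ih, ← sub_eq_zero, ← map_sub]
      exact proj_eq_zero_of_le ((hW hm).trans hn) (hy m)
  choose n hn using hcof
  refine ⟨mk (fun N => proj E N (y (n N))) fun N N' h => ?_, fun k => ?_⟩
  · rw [transition_proj]
    rw [← hle N' (n N') (hn N') _ (le_max_left (n N') (n N)),
      ← hle N' (n N) ((hn N).trans h) _ (le_max_right (n N') (n N))]
  · rw [map_sub, proj_mk, sub_eq_zero, ← hle _ _ (hn (W k)) _ (le_max_left _ k),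
      ← hle _ k le_rfl _ (le_max_right _ k)]

end

/-- A filtration of `G` by open subgroups that resembles `p ^ n ℤ_p ^ d`, together with a family
of topological generators. -/
structure IsPowerFiltration (p : ℕ) {ι G : Type*} [CommGroup G] [TopologicalSpace G]
    (u : ι → G) (W : ℕ → OpenSubgroup G) : Prop where
  antitone : Antitone W
  zero : W 0 = ⊤
  cofinal : ∀ N, ∃ n, W n ≤ N
  pow_mem : ∀ i n, u i ^ p ^ n ∈ W n
  le_closure : ∀ n, (W n : Subgroup G) ≤
    Subgroup.closure (Set.range fun i => u i ^ p ^ n) ⊔ (W (n + 1) : Subgroup G)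

section

variable {p : ℕ} [hp : Fact p.Prime] {E : Type*} [Field E] [CharP E p] {G : Type*} [CommGroup G]
  [TopologicalSpace G] {ι : Type*} {u : ι → G} {W : ℕ → OpenSubgroup G}

variable (p E G) in
omit hp in
theorem charP : CharP (CompletedGroupAlgebra E G) p := by
  have : Nontrivial (CompletedGroupAlgebra E G) := (augmentation E G).toRingHom.domain_nontrivial
  exact charP_of_injective_algebraMap (algebraMap E (CompletedGroupAlgebra E G)).injective p

theorem of_sub_one_pow (g : G) (n : ℕ) : (of E g - 1) ^ p ^ n = of E (g ^ p ^ n) - 1 := by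
  have := charP p E G
  rw [sub_pow_char_pow, one_pow, map_pow]

theorem proj_of_sub_one_pow (h : IsPowerFiltration p u W) (i : ι) {n k : ℕ} (hk : p ^ n ≤ k) :
    proj E (W n) ((of E (u i) - 1) ^ k) = 0 := by
  obtain ⟨l, rfl⟩ := Nat.exists_eq_add_of_le hk
  have h1 : ((u i ^ p ^ n : G) : G ⧸ (W n : Subgroup G)) = 1 :=
    (QuotientGroup.eq_one_iff _).2 (h.pow_mem i n)
  rw [pow_add, map_mul, of_sub_one_pow, map_sub, proj_of, h1, map_one, map_one, sub_self, zero_mul]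

variable [Finite ι]

/-- One step of the successive approximation in `mem_span_of_proj_eq_zero`. Modulo `W (n + 1)`, the
group `W n` is generated by the `u i ^ p ^ n`, and `u i ^ p ^ n - 1 = (u i - 1) ^ p ^ n` in
characteristic `p`. -/
theorem exists_approx (h : IsPowerFiltration p u W) (n : ℕ) (x : CompletedGroupAlgebra E G)
    (hx : proj E (W n) x = 0) :
    ∃ z : ι → CompletedGroupAlgebra E G,
      proj E (W (n + 1)) (x - ∑ᶠ i, z i * (of E (u i) - 1) ^ p ^ n) = 0 := by
  have := Fintype.ofFinite ι
  simp only [finsum_eq_sum_of_fintype]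
  have hker : (QuotientGroup.map (W (n + 1) : Subgroup G) (W n : Subgroup G) (MonoidHom.id G)
      (h.antitone n.le_succ)).ker ≤
      Subgroup.closure (Set.range fun i => ((u i ^ p ^ n : G) : G ⧸ (W (n + 1) : Subgroup G))) := by
    intro g hg
    obtain ⟨g, rfl⟩ := QuotientGroup.mk_surjective g
    have hg' : g ∈ (W n : Subgroup G) := (QuotientGroup.eq_one_iff _).1 hg
    obtain ⟨a, ha, b, hb, rfl⟩ := Subgroup.mem_sup.1 (h.le_closure n hg')
    have hb' : ((b : G) : G ⧸ (W (n + 1) : Subgroup G)) = 1 := (QuotientGroup.eq_one_iff _).2 hb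
    rw [QuotientGroup.mk_mul, hb', mul_one]
    have := Subgroup.mem_map_of_mem (QuotientGroup.mk' (W (n + 1) : Subgroup G)) ha
    rwa [MonoidHom.map_closure, ← Set.range_comp] at this
  have hmem := MonoidAlgebra.mem_span_of_mapDomainAlgHom_eq_zero (E := E) _ hker
    (x := proj E (W (n + 1)) x) ((transition_proj (h.antitone n.le_succ) x).trans hx)
  rw [← Set.range_comp, Ideal.mem_span_range_iff_exists_fun] at hmem
  obtain ⟨c, hc⟩ := hmem
  choose z hz using fun i => proj_surjective (W (n + 1)) (c i)
  refine ⟨z, ?_⟩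
  rw [map_sub, ← hc, map_sum, sub_eq_zero]
  refine Finset.sum_congr rfl fun i _ => ?_
  rw [map_mul, hz, of_sub_one_pow, map_sub, proj_of, map_one]
  rfl

/-- The kernel of `E[[G]] → E[G/W n]` is generated by the `(u i - 1) ^ (p ^ n)`. -/
theorem mem_span_of_proj_eq_zero (h : IsPowerFiltration p u W) (n : ℕ)
    (x : CompletedGroupAlgebra E G) (hx : proj E (W n) x = 0) :
    x ∈ Ideal.span (Set.range fun i => (of E (u i) - 1) ^ p ^ n) := by
  have := Fintype.ofFinite ι
  have happ := fun m (y : CompletedGroupAlgebra E G) (hy : proj E (W m) y = 0) =>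
    exists_approx h m y hy
  simp only [finsum_eq_sum_of_fintype] at happ
  let T := fun i => of E (u i) - 1
  let S := fun s : ℕ => {z : ι → CompletedGroupAlgebra E G //
    proj E (W (n + s + 1)) (x - ∑ i, z i * T i ^ p ^ n) = 0}
  have step : ∀ s (z : S s), ∃ z' : S (s + 1), ∀ i, proj E (W s) (z'.1 i - z.1 i) = 0 := by
    rintro s ⟨z, hz⟩
    obtain ⟨y, hy⟩ := happ _ _ hz
    -- The new error is a combination of the `T i ^ p ^ (n + s + 1)`. After extracting `T i ^ p ^
    -- n`, at least `p ^ s` factors `T i` remain, so the correction to the coefficients dies modulo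
    -- `W s` and the coefficients converge.
    have hpow : p ^ n + p ^ s ≤ p ^ (n + s + 1) := by
      have h1 : p ^ n ≤ p ^ (n + s) := Nat.pow_le_pow_right hp.out.pos (by omega)
      have h2 : p ^ s ≤ p ^ (n + s) := Nat.pow_le_pow_right hp.out.pos (by omega)
      have h3 : p ^ (n + s) * 2 ≤ p ^ (n + s) * p := Nat.mul_le_mul_left _ hp.out.two_le
      rw [pow_succ]
      omega
    obtain ⟨k, hk⟩ := Nat.exists_eq_add_of_le hpow
    refine ⟨⟨fun i => z i + y i * T i ^ (p ^ s + k), ?_⟩, fun i => ?_⟩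
    · have : x - ∑ i, (z i + y i * T i ^ (p ^ s + k)) * T i ^ p ^ n =
          x - ∑ i, z i * T i ^ p ^ n - ∑ i, y i * T i ^ p ^ (n + s + 1) := by
        rw [sub_sub, ← Finset.sum_add_distrib]
        congr 1
        refine Finset.sum_congr rfl fun i _ => ?_
        rw [hk]
        ring
      rw [this]
      exact hy
    · rw [add_sub_cancel_left, map_mul, proj_of_sub_one_pow h i (Nat.le_add_right _ _), mul_zero]
  choose next hnext using step
  obtain ⟨z₀, hz₀⟩ := happ n x hx
  let Z : ∀ s, S s := fun s => Nat.rec ⟨z₀, hz₀⟩ (fun s z => next s z) s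
  choose l hl using fun i => exists_limit h.antitone h.cofinal (fun s => (Z s).1 i)
    fun s => hnext s (Z s) i
  refine (Ideal.mem_span_range_iff_exists_fun).2 ⟨l, ?_⟩
  rw [eq_comm, ← sub_eq_zero]
  ext1 N
  obtain ⟨s, hs⟩ := h.cofinal N
  refine (proj_eq_zero_of_le hs ?_).trans (map_zero _).symm
  have h1 : x - ∑ i, l i * T i ^ p ^ n =
      x - ∑ i, (Z s).1 i * T i ^ p ^ n - ∑ i, (l i - (Z s).1 i) * T i ^ p ^ n := by
    rw [sub_sub, ← Finset.sum_add_distrib]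
    congr 1
    exact Finset.sum_congr rfl fun i _ => by ring
  change proj E (W s) (x - ∑ i, l i * T i ^ p ^ n) = 0
  rw [h1, map_sub, proj_eq_zero_of_le (h.antitone (by omega)) (Z s).2, map_sum, zero_sub,
    neg_eq_zero]
  exact Finset.sum_eq_zero fun i _ => by rw [map_mul, hl, zero_mul]

theorem mem_span_of_augmentation_eq_zero (h : IsPowerFiltration p u W)
    (x : CompletedGroupAlgebra E G) (hx : augmentation E G x = 0) :
    x ∈ Ideal.span (Set.range fun i => of E (u i) - 1) := by
  simpa using mem_span_of_proj_eq_zero h 0 x (proj_eq_zero_of_augmentation_eq_zero h.zero hx)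

/-- The finitely many `u i - 1` become nilpotent in each `E[G/W n]`, so some power of the ideal they
generate maps to zero there. -/
theorem isHausdorff (h : IsPowerFiltration p u W) :
    IsHausdorff (Ideal.span (Set.range fun i => of E (u i) - 1)) (CompletedGroupAlgebra E G) := by
  refine ⟨fun x hx => ?_⟩
  ext1 N
  obtain ⟨n, hn⟩ := h.cofinal N
  refine (proj_eq_zero_of_le hn ?_).trans (map_zero _).symm
  obtain ⟨k, hk⟩ := Ideal.exists_pow_map_eq_zero
    (proj E (W n)).toRingHom (fun i => of E (u i) - 1)
    fun i => ⟨p ^ n, (map_pow (proj E (W n)) _ _).symm.trans (proj_of_sub_one_pow h i le_rfl)⟩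
  have hxk := hx k
  rw [SModEq.zero, smul_eq_mul, Ideal.mul_top] at hxk
  exact hk x hxk

/-- The assignment `X i ↦ u i - 1` extends to power series level by level. Modulo the ideal of the
variables, whose image generates the augmentation ideal, constants already suffice; completeness of
the source and separatedness of the target give surjectivity. -/
theorem isNoetherianRing (h : IsPowerFiltration p u W) :
    IsNoetherianRing (CompletedGroupAlgebra E G) := by
  have hnil : ∀ (N : OpenSubgroup G) i, IsNilpotent (proj E N (of E (u i) - 1)) := by
    intro N i
    obtain ⟨n, hn⟩ := h.cofinal N
    refine ⟨p ^ n, ?_⟩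
    rw [← map_pow]
    exact proj_eq_zero_of_le hn (proj_of_sub_one_pow h i le_rfl)
  let ψ : MvPowerSeries ι E →ₐ[E] CompletedGroupAlgebra E G :=
    AlgHom.codRestrict (AlgHom.pi fun N => MvPowerSeries.nilpotentEval (E := E) _ (hnil N))
      (compatibleFamilies E G) (fun x N N' hN =>
        MvPowerSeries.map_nilpotentEval _ (hnil N) _ _ (hnil N') (fun i => transition_proj hN _) x)
  have hψ : ∀ N x, proj E N (ψ x) = MvPowerSeries.nilpotentEval _ (hnil N) x := fun N x => rfl
  have hψX : ∀ i, ψ (MvPowerSeries.X i) = of E (u i) - 1 := by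
    intro i
    ext1 N
    rw [hψ, MvPowerSeries.nilpotentEval_X]
  have hψC : ∀ c : E, ψ (algebraMap E _ c) = algebraMap E _ c := ψ.commutes
  have hmap : (Ideal.span (Set.range MvPowerSeries.X)).map ψ.toRingHom =
      Ideal.span (Set.range fun i => of E (u i) - 1) := by
    rw [Ideal.map_span, ← Set.range_comp]
    congr 2
    exact funext hψX
  have : IsHausdorff ((Ideal.span (Set.range MvPowerSeries.X)).map ψ.toRingHom)
      (CompletedGroupAlgebra E G) := hmap ▸ isHausdorff h
  refine isNoetherianRing_of_surjective _ _ ψ.toRingHom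
    (surjective_of_mk_map_comp_surjective (I := Ideal.span (Set.range MvPowerSeries.X))
      ψ.toRingHom ?_)
  intro x
  obtain ⟨x, rfl⟩ := Ideal.Quotient.mk_surjective x
  refine ⟨algebraMap E _ (augmentation E G x), ?_⟩
  have hC : ψ.toRingHom (algebraMap E _ (augmentation E G x)) = _ := hψC _
  rw [RingHom.comp_apply, hC, Ideal.Quotient.eq, hmap]
  apply mem_span_of_augmentation_eq_zero h
  rw [map_sub, AlgHom.commutes, Algebra.algebraMap_self_apply, sub_self]

end

end CompletedGroupAlgebra

end

/-! ### Subgroups of `G` cut out by a valuation on `E[[G]]`. -/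

noncomputable section

/-- Changing each factor by something smaller than itself preserves the leading term of the product.
-/
theorem Valuation.map_prod_sub_prod_lt {R Γ₀ ι : Type*} [CommRing R]
    [LinearOrderedCommGroupWithZero Γ₀] (v : Valuation R Γ₀) (s : Finset ι) (a b : ι → R)
    (h : ∀ i ∈ s, v (a i - b i) < v (b i)) :
    v (∏ i ∈ s, a i - ∏ i ∈ s, b i) < v (∏ i ∈ s, b i) := by
  classical
  induction s using Finset.induction_on with
  | empty => simp
  | insert j s hj ih =>
    have h1 := h j (Finset.mem_insert_self j s)
    have h2 := ih fun i hi => h i (Finset.mem_insert_of_mem hi)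
    rw [Finset.prod_insert hj, Finset.prod_insert hj]
    have h3 : v (∏ i ∈ s, a i) = v (∏ i ∈ s, b i) := v.map_eq_of_sub_lt h2
    have : a j * ∏ i ∈ s, a i - b j * ∏ i ∈ s, b i =
        (a j - b j) * ∏ i ∈ s, a i + b j * (∏ i ∈ s, a i - ∏ i ∈ s, b i) := by ring
    rw [this, map_mul]
    refine v.map_add_lt ?_ ?_
    · rw [map_mul, h3]
      exact mul_lt_mul_of_pos_right h1 (zero_le.trans_lt h2)
    · rw [map_mul]
      exact mul_lt_mul_of_pos_left h2 (zero_le.trans_lt h1)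

namespace CompletedGroupAlgebra

section

variable {E : Type*} [Field E] {G : Type*} [CommGroup G] [TopologicalSpace G]
  {Γ₀ : Type*} [LinearOrderedCommGroupWithZero Γ₀] {v : Valuation (CompletedGroupAlgebra E G) Γ₀}

theorem valuation_of (hv : ∀ x, v x ≤ 1) (g : G) : v (of E g) = 1 := by
  refine le_antisymm (hv _) ?_
  have h : v (of E g) * v (of E g⁻¹) = 1 := by rw [← map_mul, ← map_mul, mul_inv_cancel, map_one,
    map_one]
  rw [← h]
  exact mul_le_of_le_one_right zero_le (hv _)

theorem valuation_of_sub_of (hv : ∀ x, v x ≤ 1) (g h : G) :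
    v (of E g - of E h) = v (of E (g / h) - 1) := by
  have : of E g - of E h = of E h * (of E (g / h) - 1) := by
    rw [mul_sub, ← map_mul, mul_div_cancel, mul_one]
  rw [this, map_mul, valuation_of hv, one_mul]

theorem valuation_algebraMap (hv : ∀ x, v x ≤ 1) {c : E} (hc : c ≠ 0) :
    v (algebraMap E _ c) = 1 := by
  refine le_antisymm (hv _) ?_
  have h : v (algebraMap E _ c) * v (algebraMap E _ c⁻¹) = 1 := by
    rw [← map_mul, ← map_mul, mul_inv_cancel₀ hc, map_one, map_one]
  rw [← h]
  exact mul_le_of_le_one_right zero_le (hv _)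

/-- The group elements `g` for which `g - 1` has valuation at most `t`. -/
def valuationSubgroup (v : Valuation (CompletedGroupAlgebra E G) Γ₀) (hv : ∀ x, v x ≤ 1) (t : Γ₀) :
    Subgroup G where
  carrier := {g | v (of E g - 1) ≤ t}
  one_mem' := by simp
  mul_mem' {g h} hg hh := by
    have : of E (g * h) - 1 = of E g * (of E h - 1) + (of E g - 1) := by rw [map_mul]; ring
    change v (of E (g * h) - 1) ≤ t
    rw [this]
    refine (v.map_add _ _).trans (max_le ?_ hg)
    rwa [map_mul, valuation_of hv, one_mul]
  inv_mem' {g} hg := by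
    change v (of E g⁻¹ - 1) ≤ t
    rw [← one_div, ← valuation_of_sub_of hv, map_one, Valuation.map_sub_swap]
    exact hg

theorem mem_valuationSubgroup {hv : ∀ x, v x ≤ 1} {t : Γ₀} {g : G} :
    g ∈ valuationSubgroup v hv t ↔ v (of E g - 1) ≤ t :=
  Iff.rfl

/-- The valuation of `g - 1` is constant on the nontrivial cosets of `valuationSubgroup v hv t`. -/
theorem valuation_of_sub_one_eq (hv : ∀ x, v x ≤ 1) {t : Γ₀} {g h : G}
    (hg : g ∉ valuationSubgroup v hv t) (hgh : h / g ∈ valuationSubgroup v hv t) :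
    v (of E h - 1) = v (of E g - 1) := by
  have : of E h - 1 = (of E h - of E g) + (of E g - 1) := by ring
  rw [this]
  refine v.map_add_eq_of_lt_right ?_
  rw [valuation_of_sub_of hv]
  exact lt_of_le_of_lt hgh (not_le.1 hg)

end

section

variable {p : ℕ} [hp : Fact p.Prime] {E : Type*} [Field E] [CharP E p] {G : Type*} [CommGroup G]
  [TopologicalSpace G] {ι : Type*} [Finite ι] {u : ι → G} {W : ℕ → OpenSubgroup G}
  {Γ₀ : Type*} [LinearOrderedCommGroupWithZero Γ₀] {v : Valuation (CompletedGroupAlgebra E G) Γ₀}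
  {α : Γ₀}

/-- The kernel at level `n` is generated by `p ^ n`-th powers of elements of augmentation zero. -/
theorem valuation_le_of_proj_eq_zero (h : IsPowerFiltration p u W) (hv : ∀ x, v x ≤ 1)
    (hα : ∀ x, augmentation E G x = 0 → v x ≤ α) {n : ℕ} {x : CompletedGroupAlgebra E G}
    (hx : proj E (W n) x = 0) : v x ≤ α ^ p ^ n := by
  refine Submodule.span_induction ?_ ?_ ?_ ?_ (mem_span_of_proj_eq_zero h n x hx)
  · rintro _ ⟨i, rfl⟩
    rw [map_pow]
    exact pow_le_pow_left₀ zero_le (hα _ (by simp)) _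
  · simp
  · intro y z _ _ hy hz
    exact (v.map_add y z).trans (max_le hy hz)
  · intro r y _ hy
    rw [smul_eq_mul, map_mul]
    exact (mul_le_of_le_one_left zero_le (hv r)).trans hy

theorem le_valuationSubgroup (h : IsPowerFiltration p u W) (hv : ∀ x, v x ≤ 1)
    (hα : ∀ x, augmentation E G x = 0 → v x ≤ α) (n : ℕ) :
    (W n : Subgroup G) ≤ valuationSubgroup v hv (α ^ p ^ n) := by
  intro g hg
  refine valuation_le_of_proj_eq_zero h hv hα ?_
  have h1 : (g : G ⧸ (W n : Subgroup G)) = 1 := (QuotientGroup.eq_one_iff _).2 hg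
  rw [map_sub, proj_of, h1, map_one, map_one, sub_self]

/-- If the valuation separates the elements of `G` from `1`, the subgroups `valuationSubgroup`
form a basis of neighbourhoods of `1`. -/
theorem exists_valuationSubgroup_le [IsTopologicalGroup G] [CompactSpace G]
    (h : IsPowerFiltration p u W) (hv : ∀ x, v x ≤ 1)
    (hα : ∀ x, augmentation E G x = 0 → v x ≤ α) (hα1 : α < 1)
    (hfin : ∀ g : G, g ≠ 1 → v (of E g - 1) ≠ 0 ∧ ∃ n : ℕ, α ^ n ≤ v (of E g - 1))
    (N : OpenSubgroup G) : ∃ k, valuationSubgroup v hv (α ^ p ^ k) ≤ (N : Subgroup G) := by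
  by_contra! hcon
  have hclosed : ∀ k, IsClosed (valuationSubgroup v hv (α ^ p ^ k) : Set G) := fun k =>
    Subgroup.isClosed_of_isOpen _ (Subgroup.isOpen_mono (le_valuationSubgroup h hv hα k) (W k).isOpen)
  -- By compactness some `g ∉ N` satisfies `v (g - 1) ≤ α ^ p ^ k` for all `k`, against the lower
  -- bound in `hfin`.
  obtain ⟨g, hg⟩ := IsCompact.nonempty_iInter_of_sequence_nonempty_isCompact_isClosed
    (fun k => (valuationSubgroup v hv (α ^ p ^ k) : Set G) \ N)
    (fun k g hg => ⟨le_trans hg.1 (pow_le_pow_of_le_one zero_le hα1.le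
      (Nat.pow_le_pow_right hp.out.pos k.le_succ)), hg.2⟩)
    (fun k => by
      obtain ⟨g, hg, hg'⟩ := SetLike.not_le_iff_exists.1 (hcon k)
      exact ⟨g, hg, hg'⟩)
    ((hclosed 0).sdiff N.isOpen).isCompact (fun k => (hclosed k).sdiff N.isOpen)
  rw [Set.mem_iInter] at hg
  have hg1 : g ≠ 1 := by
    rintro rfl
    exact (hg 0).2 N.one_mem
  obtain ⟨h0, n, hn⟩ := hfin g hg1
  have hle : v (of E g - 1) ≤ α := hα _ (by simp)
  have hα0 : 0 < α := lt_of_lt_of_le (zero_lt_iff.2 h0) hle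
  have h1 : α ^ n ≤ α ^ p ^ n := hn.trans (hg n).1
  exact absurd h1 (not_le.2 (pow_lt_pow_right_of_lt_one₀ hα0 hα1 (Nat.lt_pow_self hp.out.one_lt)))

end

end CompletedGroupAlgebra
end

/-! ### Coset products and the interpolation operator. -/

noncomputable section

namespace CompletedGroupAlgebra

section

variable {E : Type*} [Field E] {G : Type*} [CommGroup G] [TopologicalSpace G]
  {Γ₀ : Type*} [LinearOrderedCommGroupWithZero Γ₀] {v : Valuation (CompletedGroupAlgebra E G) Γ₀}
  {t : Γ₀} {V : Subgroup G}

/-- The product of `g - w` over representatives `w` of the nontrivial cosets of `V`. -/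
def cosetProd (E : Type*) [Field E] (V : Subgroup G) [Fintype (G ⧸ V)] [DecidableEq (G ⧸ V)]
    (g : G) : CompletedGroupAlgebra E G :=
  ∏ e ∈ (Finset.univ : Finset (G ⧸ V)).erase 1, (of E g - of E e.out)

omit [TopologicalSpace G] in
theorem div_out_mem_iff {V : Subgroup G} (g : G) (e : G ⧸ V) :
    g / e.out ∈ V ↔ (g : G ⧸ V) = e := by
  rw [← QuotientGroup.eq_one_iff, QuotientGroup.mk_div, QuotientGroup.out_eq', div_eq_one]

variable [Fintype (G ⧸ V)] [DecidableEq (G ⧸ V)]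

/-- Replacing `1` by `g ∈ V` alters each factor `1 - w` by `g - 1`, of value at most `t`, whereas `w
∉ V` means that `v (1 - w) > t`. -/
theorem valuation_cosetProd_sub_lt (hv : ∀ x, v x ≤ 1) (hV : V = valuationSubgroup v hv t)
    {g : G} (hg : g ∈ V) :
    v (cosetProd E V g - cosetProd E V 1) <
      v (cosetProd E V 1) := by
  refine v.map_prod_sub_prod_lt _ _ _ fun e he => ?_
  rw [sub_sub_sub_cancel_right, map_one, ← map_one (of E), valuation_of_sub_of hv 1]
  refine lt_of_le_of_lt (hV ▸ hg : g ∈ valuationSubgroup v hv t) (not_le.1 fun h => ?_)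
  rw [← mem_valuationSubgroup (hv := hv), ← hV, div_out_mem_iff] at h
  exact (Finset.ne_of_mem_erase he) h.symm

/-- Let `c` be the coset of `g`. The values of `g - w` and `1 - w` depend only on cosets as long as
they exceed `t`, so the factors for `e ≠ 1, c` on the left match those for `e / c` on the right.
What remains is the factor at `c` on the left, at most `t`, and the one at `c⁻¹` on the right,
greater than `t`. -/
theorem valuation_cosetProd_lt (hv : ∀ x, v x ≤ 1) (hV : V = valuationSubgroup v hv t) {g : G}
    (hg : g ∉ V) :
    v (cosetProd E V g) <
      v (cosetProd E V 1) := by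
  set c : G ⧸ V := (g : G ⧸ V) with hc
  have hc1 : c ≠ 1 := fun h => hg ((QuotientGroup.eq_one_iff g).1 h)
  have hci : c⁻¹ ≠ 1 := inv_ne_one.2 hc1
  have hlt : ∀ (w : G) (e : G ⧸ V), (w : G ⧸ V) ≠ e → t < v (of E w - of E e.out) := by
    intro w e hwe
    rw [valuation_of_sub_of hv]
    refine not_le.1 fun h => hwe ?_
    rw [← mem_valuationSubgroup (hv := hv), ← hV, div_out_mem_iff] at h
    exact h
  simp only [cosetProd, map_prod]
  rw [← Finset.mul_prod_erase _ _ (Finset.mem_erase.2 ⟨hc1, Finset.mem_univ c⟩),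
    ← Finset.mul_prod_erase _ _ (Finset.mem_erase.2 ⟨hci, Finset.mem_univ c⁻¹⟩)]
  have hprod : ∏ e ∈ ((Finset.univ : Finset (G ⧸ V)).erase 1).erase c, v (of E g - of E e.out) =
      ∏ e ∈ ((Finset.univ : Finset (G ⧸ V)).erase 1).erase c⁻¹, v (of E 1 - of E e.out) := by
    refine Finset.prod_nbij' (fun e => e / c) (fun e => e * c) ?_ ?_ ?_ ?_ ?_
    · intro e he
      simp only [Finset.mem_erase, Finset.mem_univ, and_true] at he ⊢
      refine ⟨fun h => he.2 ?_, fun h => he.1 (div_eq_one.1 h)⟩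
      rwa [div_eq_mul_inv, mul_eq_right] at h
    · intro e he
      simp only [Finset.mem_erase, Finset.mem_univ, and_true] at he ⊢
      exact ⟨fun h => he.2 (mul_eq_right.1 h), fun h => he.1 (eq_inv_of_mul_eq_one_left h)⟩
    · simp
    · simp
    · intro e he
      simp only [Finset.mem_erase, Finset.mem_univ, and_true] at he
      rw [valuation_of_sub_of hv, valuation_of_sub_of hv]
      refine valuation_of_sub_one_eq hv (t := t) ?_ ?_
      · rw [← hV, div_out_mem_iff]
        intro h
        exact he.1 (div_eq_one.1 h.symm)
      · rw [← hV, ← QuotientGroup.eq_one_iff]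
        simp only [QuotientGroup.mk_div, QuotientGroup.out_eq', QuotientGroup.mk_one, ← hc]
        rw [one_div_div, div_self']
  rw [hprod]
  refine mul_lt_mul_of_pos_right ?_ ?_
  · refine lt_of_le_of_lt ?_ (hlt 1 c⁻¹ fun h => hci h.symm)
    rw [valuation_of_sub_of hv, ← mem_valuationSubgroup (hv := hv), ← hV, div_out_mem_iff]
  · refine Finset.prod_induction _ (fun x => 0 < x) (fun _ _ => mul_pos) one_pos fun e he => ?_
    simp only [Finset.mem_erase, Finset.mem_univ, and_true] at he
    exact zero_le.trans_lt (hlt 1 e fun h => he.2 h.symm)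

end

section

variable {p : ℕ} [hp : Fact p.Prime] {E : Type*} [Field E] [CharP E p] {G : Type*} [CommGroup G]
  [TopologicalSpace G]

/-- The operator `∑ gₘ Φₘ`, for the polynomial `∑ gₘ Xᵐ` with roots `w ^ q`, `w` running over
representatives of the nontrivial cosets of `V`. -/
def interpolation (V : Subgroup G) [Fintype (G ⧸ V)] [DecidableEq (G ⧸ V)]
    (q : ℕ) (Φ : ℕ → CompletedGroupAlgebra E G →ₐ[E] CompletedGroupAlgebra E G) :
    CompletedGroupAlgebra E G →ₗ[E] CompletedGroupAlgebra E G :=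
  let g := ∏ e ∈ (Finset.univ : Finset (G ⧸ V)).erase 1,
    (Polynomial.X - Polynomial.C (of E e.out ^ q))
  ∑ m ∈ Finset.range (g.natDegree + 1), LinearMap.mulLeft E (g.coeff m) ∘ₗ (Φ m).toLinearMap

variable {V : Subgroup G} [Fintype (G ⧸ V)] [DecidableEq (G ⧸ V)]
  {Φ : ℕ → CompletedGroupAlgebra E G →ₐ[E] CompletedGroupAlgebra E G}

theorem interpolation_mem {q : ℕ} (I : Ideal (CompletedGroupAlgebra E G))
    {x : CompletedGroupAlgebra E G} (hx : ∀ m, Φ m x ∈ I) : interpolation V q Φ x ∈ I := by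
  simp only [interpolation, LinearMap.sum_apply, LinearMap.comp_apply, LinearMap.mulLeft_apply]
  exact sum_mem fun m _ => I.mul_mem_left _ (hx m)

/-- The sum is `g` times the value at `g ^ q` of the polynomial with roots `w ^ q`, where `q = p ^
K`. In characteristic `p` that value is `∏ (g - w) ^ q`. -/
theorem interpolation_of {K : ℕ} (hΦ : ∀ m g, Φ m (of E g) = of E g ^ (1 + p ^ K * m)) (g : G) :
    interpolation V (p ^ K) Φ (of E g) = of E g * cosetProd E V g ^ p ^ K := by
  have := charP p E G
  simp only [interpolation, LinearMap.sum_apply, LinearMap.comp_apply, LinearMap.mulLeft_apply,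
    AlgHom.toLinearMap_apply, hΦ]
  set f := ∏ e ∈ (Finset.univ : Finset (G ⧸ V)).erase 1,
    (Polynomial.X - Polynomial.C (of E e.out ^ p ^ K)) with hf
  have h1 : f.eval (of E g ^ p ^ K) = cosetProd E V g ^ p ^ K := by
    simp only [hf, Polynomial.eval_prod, Polynomial.eval_sub, Polynomial.eval_X, Polynomial.eval_C,
      cosetProd, ← Finset.prod_pow, sub_pow_char_pow]
  rw [← h1, Polynomial.eval_eq_sum_range, Finset.mul_sum]
  refine Finset.sum_congr rfl fun m _ => ?_
  rw [pow_add, pow_mul, pow_one]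
  ring

/-- The coefficient at `1` of the image of `x` in `E[G/N]`. -/
theorem coeff_proj_of_inv_mul (N : OpenSubgroup G) (g : G) (x : CompletedGroupAlgebra E G) :
    (proj E N (of E g⁻¹ * x)).coeff 1 = (proj E N x).coeff (g : G ⧸ (N : Subgroup G)) := by
  rw [map_mul, proj_of, MonoidAlgebra.of_apply, MonoidAlgebra.coeff_single_mul_apply]
  simp

variable {ι : Type*} [Finite ι] {u : ι → G} {W : ℕ → OpenSubgroup G}
  {Γ₀ : Type*} [LinearOrderedCommGroupWithZero Γ₀] {v : Valuation (CompletedGroupAlgebra E G) Γ₀}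
  {α : Γ₀}

/-- If an element of the support of a valuation `v` stays in the support under operators `Φ m`
acting on `G` by `g ↦ g ^ (1 + p ^ K * m)`, its image in `E[G/V]` has no coefficient at `1`, where
`V` is a subgroup defined by the valuation. -/
theorem coeff_proj_eq_zero (h : IsPowerFiltration p u W) (hv : ∀ x, v x ≤ 1)
    (hα : ∀ x, augmentation E G x = 0 → v x ≤ α) (hα0 : 0 < α) (hα1 : α < 1)
    (hfin : ∀ x, v x ≠ 0 → ∃ n : ℕ, α ^ n ≤ v x) {t : Γ₀} (ht : t < 1) {k : ℕ}
    (N : OpenSubgroup G) (hN : (N : Subgroup G) = valuationSubgroup v hv t) (hk : W k ≤ N)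
    [Finite (G ⧸ (N : Subgroup G))] {K : ℕ}
    (hΦ : ∀ m g, Φ m (of E g) = of E g ^ (1 + p ^ K * m))
    (hΦW : ∀ m n x, proj E (W n) x = 0 → proj E (W n) (Φ m x) = 0)
    {f : CompletedGroupAlgebra E G} (hf : ∀ m, v (Φ m f) = 0) :
    (proj E N f).coeff 1 = 0 := by
  classical
  have := charP p E G
  have := Fintype.ofFinite (G ⧸ (N : Subgroup G))
  set D := cosetProd E (N : Subgroup G) 1 with hD
  have hq : p ^ K ≠ 0 := (pow_pos hp.out.pos K).ne'
  have hD0 : 0 < v D := zero_le.trans_lt (valuation_cosetProd_sub_lt hv hN (one_mem _))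
  have hDK0 : 0 < v (D ^ p ^ K) := by rw [map_pow]; exact pow_pos hD0 _
  let T := interpolation (N : Subgroup G) (p ^ K) Φ
  -- the operator `T` is close to `D ^ q` on `N` and small on the other cosets
  have hTin : ∀ g ∈ (N : Subgroup G), v (T (of E g) - D ^ p ^ K) < v (D ^ p ^ K) := by
    intro g hg
    have h1 := valuation_cosetProd_sub_lt hv hN hg
    have h2 : v (cosetProd E (N : Subgroup G) g) = v D := v.map_eq_of_sub_lt h1
    have h3 : T (of E g) - D ^ p ^ K = (of E g - 1) * cosetProd E (N : Subgroup G) g ^ p ^ K +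
        (cosetProd E (N : Subgroup G) g - D) ^ p ^ K := by
      rw [sub_pow_char_pow]
      simp only [T, interpolation_of hΦ]
      ring
    rw [h3]
    refine v.map_add_lt ?_ ?_
    · rw [map_mul, map_pow, h2, ← map_pow]
      refine mul_lt_of_lt_one_left hDK0 (lt_of_le_of_lt ?_ ht)
      rw [hN] at hg
      exact hg
    · rw [map_pow, map_pow]
      exact pow_lt_pow_left₀ h1 zero_le hq
  have hTout : ∀ g ∉ (N : Subgroup G), v (T (of E g)) < v (D ^ p ^ K) := by
    intro g hg
    simp only [T, interpolation_of hΦ]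
    rw [map_mul, valuation_of hv, one_mul, map_pow, map_pow]
    exact pow_lt_pow_left₀ (valuation_cosetProd_lt hv hN hg) zero_le hq
  -- By linearity, on finite combinations of group elements `T` has leading term `D ^ q` times the
  -- coefficient at the coset of `1`.
  have hspan : ∀ y ∈ Submodule.span E (Set.range (of E (G := G))),
      v (T y - algebraMap E _ ((proj E N y).coeff 1) * D ^ p ^ K) < v (D ^ p ^ K) := by
    intro y hy
    refine Submodule.span_induction ?_ ?_ ?_ ?_ hy
    · rintro _ ⟨g, rfl⟩
      rw [proj_of, MonoidAlgebra.of_apply, MonoidAlgebra.coeff_single, Finsupp.single_apply]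
      by_cases hg : g ∈ (N : Subgroup G)
      · rw [if_pos ((QuotientGroup.eq_one_iff g).2 hg), map_one, one_mul]
        exact hTin g hg
      · rw [if_neg (fun h => hg ((QuotientGroup.eq_one_iff g).1 h)), map_zero, zero_mul, sub_zero]
        exact hTout g hg
    · simpa using hDK0
    · intro x y _ _ hx hy
      have : T (x + y) - algebraMap E _ ((proj E N (x + y)).coeff 1) * D ^ p ^ K =
          (T x - algebraMap E _ ((proj E N x).coeff 1) * D ^ p ^ K) +
          (T y - algebraMap E _ ((proj E N y).coeff 1) * D ^ p ^ K) := by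
        rw [map_add, map_add, MonoidAlgebra.coeff_add, Finsupp.add_apply, map_add]
        ring
      rw [this]
      exact v.map_add_lt hx hy
    · intro r x _ hx
      have : T (r • x) - algebraMap E _ ((proj E N (r • x)).coeff 1) * D ^ p ^ K =
          algebraMap E _ r * (T x - algebraMap E _ ((proj E N x).coeff 1) * D ^ p ^ K) := by
        rw [map_smul, map_smul, MonoidAlgebra.coeff_smul, Finsupp.smul_apply, smul_eq_mul,
          map_mul, Algebra.smul_def]
        ring
      rw [this, map_mul]
      exact lt_of_le_of_lt (mul_le_of_le_one_left zero_le (hv _)) hx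
  -- Here `f` is approximated modulo `W (n + k)` by a finite combination `y`. The `n` makes the
  -- error `T (f - y)` smaller than `D ^ q`; the `k` ensures that `f` and `y` agree in `E[G/N]`.
  obtain ⟨n, hn⟩ := hfin _ hDK0.ne'
  obtain ⟨y, hy, hyf⟩ := exists_mem_span_proj_eq (W (n + k)) (proj E (W (n + k)) f)
  have hr : proj E (W (n + k)) (f - y) = 0 := by rw [map_sub, hyf, sub_self]
  have hTr : v (T (f - y)) < v (D ^ p ^ K) := by
    have hker : proj E (W (n + k)) (T (f - y)) = 0 :=
      interpolation_mem (RingHom.ker (proj E (W (n + k)))) fun m => hΦW m _ _ hr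
    refine lt_of_le_of_lt (valuation_le_of_proj_eq_zero h hv hα hker) (lt_of_lt_of_le ?_ hn)
    exact pow_lt_pow_right_of_lt_one₀ hα0 hα1
      (lt_of_le_of_lt (Nat.le_add_right n k) (Nat.lt_pow_self hp.out.one_lt))
  have hTf : v (T f) = 0 := by
    have : T f ∈ v.supp := interpolation_mem v.supp hf
    exact this
  have hpr : proj E N f = proj E N y := by
    rw [← sub_eq_zero, ← map_sub]
    exact proj_eq_zero_of_le ((h.antitone (Nat.le_add_left k n)).trans hk) hr
  by_contra hne
  have h1 := hspan y hy
  rw [← hpr] at h1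
  have h2 : algebraMap E _ ((proj E N f).coeff 1) * D ^ p ^ K =
      T f - T (f - y) - (T y - algebraMap E _ ((proj E N f).coeff 1) * D ^ p ^ K) := by
    rw [map_sub]
    ring
  have h3 : v (algebraMap E _ ((proj E N f).coeff 1) * D ^ p ^ K) < v (D ^ p ^ K) := by
    rw [h2]
    refine v.map_sub_lt (v.map_sub_lt ?_ hTr) h1
    rwa [hTf]
  rw [map_mul, valuation_algebraMap hv hne, one_mul] at h3
  exact lt_irrefl _ h3

end

end CompletedGroupAlgebra
end

/-! ### Stable primes modulo which `G` is faithful. -/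

noncomputable section

namespace CompletedGroupAlgebra

variable {p : ℕ} [hp : Fact p.Prime] {E : Type*} [Field E] [CharP E p] {G : Type*} [CommGroup G]
  [TopologicalSpace G]

theorem augmentation_eq_zero_of_mem (hG : ∀ (N : OpenSubgroup G) (g : G), ∃ k : ℕ, g ^ p ^ k ∈ N)
    {P : Ideal (CompletedGroupAlgebra E G)} (hP : P ≠ ⊤) {x : CompletedGroupAlgebra E G}
    (hx : x ∈ P) : augmentation E G x = 0 := by
  by_contra h
  exact hP (P.eq_top_of_isUnit_mem hx (isUnit_of_augmentation_ne_zero p hG x h))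

variable {ι : Type*} [Finite ι] {u : ι → G} {W : ℕ → OpenSubgroup G}

/-- A prime ideal of `E[[G]]` to which `G` is faithful, stable under the automorphisms
`g ↦ g ^ (1 + p ^ K * m)`, is zero. -/
theorem eq_bot_of_faithful [IsTopologicalGroup G] [CompactSpace G] [Nontrivial G]
    (h : IsPowerFiltration p u W) (hG : ∀ (N : OpenSubgroup G) (g : G), ∃ k : ℕ, g ^ p ^ k ∈ N)
    (P : Ideal (CompletedGroupAlgebra E G)) [P.IsPrime] (hfaith : ∀ g, of E g - 1 ∈ P → g = 1)
    {K : ℕ} {Φ : ℕ → CompletedGroupAlgebra E G →ₐ[E] CompletedGroupAlgebra E G}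
    (hΦ : ∀ m g, Φ m (of E g) = of E g ^ (1 + p ^ K * m))
    (hΦW : ∀ m n x, proj E (W n) x = 0 → proj E (W n) (Φ m x) = 0)
    (hΦP : ∀ m, ∀ x ∈ P, Φ m x ∈ P) : P = ⊥ := by
  have := isNoetherianRing (E := E) h
  have := isLocalRing (E := E) p hG
  have hPtop : P ≠ ⊤ := Ideal.IsPrime.ne_top inferInstance
  let A := CompletedGroupAlgebra E G ⧸ P
  have : IsLocalRing A := IsLocalRing.of_surjective' (Ideal.Quotient.mk P)
    Ideal.Quotient.mk_surjective
  have hmA : ∀ x, augmentation E G x = 0 → Ideal.Quotient.mk P x ∈ IsLocalRing.maximalIdeal A := by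
    intro x hx
    rw [IsLocalRing.mem_maximalIdeal, mem_nonunits_iff]
    intro hu
    obtain ⟨y, hy⟩ := hu.exists_right_inv
    obtain ⟨y, rfl⟩ := Ideal.Quotient.mk_surjective y
    rw [← map_mul, ← map_one (Ideal.Quotient.mk P), Ideal.Quotient.eq] at hy
    have := augmentation_eq_zero_of_mem hG hPtop hy
    simp [hx] at this
  obtain ⟨g₀, hg₀⟩ := exists_ne (1 : G)
  have hg₀' : Ideal.Quotient.mk P (of E g₀ - 1) ≠ 0 := fun h0 =>
    hg₀ (hfaith g₀ (Ideal.Quotient.eq_zero_iff_mem.1 h0))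
  -- Faithfulness and `g₀ ≠ 1` give a nonzero nonunit of `A`.
  have hA : IsLocalRing.maximalIdeal A ≠ ⊥ := by
    intro hbot
    have := hmA (of E g₀ - 1) (by simp)
    rw [hbot, Ideal.mem_bot] at this
    exact hg₀' this
  obtain ⟨Γ₀, _, w, α, hw1, hα1, hwα, hwfin⟩ := IsLocalRing.exists_valuation A hA
  let v : Valuation (CompletedGroupAlgebra E G) Γ₀ := w.comap (Ideal.Quotient.mk P)
  have hv : ∀ x, v x ≤ 1 := fun x => hw1 _
  have hα : ∀ x, augmentation E G x = 0 → v x ≤ α := fun x hx => hwα _ (hmA x hx)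
  have hvP : ∀ x ∈ P, v x = 0 := by
    intro x hx
    rw [Valuation.comap_apply, Ideal.Quotient.eq_zero_iff_mem.2 hx, map_zero]
  have hfin : ∀ x, v x ≠ 0 → ∃ n : ℕ, α ^ n ≤ v x := fun x hx =>
    (hwfin (Ideal.Quotient.mk P x) fun h0 => hx (by rw [Valuation.comap_apply, h0, map_zero])).2
  have hfaith' : ∀ g : G, g ≠ 1 → v (of E g - 1) ≠ 0 := fun g hg =>
    (hwfin _ fun h0 => hg (hfaith g (Ideal.Quotient.eq_zero_iff_mem.1 h0))).1
  have hα0 : 0 < α :=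
    lt_of_lt_of_le (zero_lt_iff.2 (hfaith' g₀ hg₀)) (hα (of E g₀ - 1) (by simp))
  refine (Submodule.eq_bot_iff P).2 fun f hf => ?_
  ext1 N
  obtain ⟨k, hk⟩ := exists_valuationSubgroup_le h hv hα hα1
    (fun g hg => ⟨hfaith' g hg, hfin _ (hfaith' g hg)⟩) N
  let V : OpenSubgroup G := ⟨valuationSubgroup v hv (α ^ p ^ k),
    Subgroup.isOpen_mono (le_valuationSubgroup h hv hα k) (W k).isOpen⟩
  have : Finite (G ⧸ (V : Subgroup G)) := Subgroup.quotient_finite_of_isOpen _ V.isOpen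
  refine (proj_eq_zero_of_le (N := V) hk ?_).trans (map_zero _).symm
  apply MonoidAlgebra.coeff_injective
  ext c
  obtain ⟨g, rfl⟩ := QuotientGroup.mk_surjective c
  -- The coefficient of `f` at the coset of `g` is that of `g⁻¹ f` at `1`, and `g⁻¹ f` is still in
  -- `P`.
  rw [← coeff_proj_of_inv_mul]
  exact coeff_proj_eq_zero h hv hα hα0 hα1 hfin
    (pow_lt_one₀ zero_le hα1 (pow_pos hp.out.pos k).ne') V rfl (le_valuationSubgroup h hv hα k)
    hΦ hΦW fun m => hvP _ (hΦP m _ (P.mul_mem_left _ hf))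

/-- The group elements trivial modulo a prime of `E[[G]]` form an isolated subgroup. -/
theorem of_sub_one_mem_of_pow (hG : ∀ (N : OpenSubgroup G) (g : G), ∃ k : ℕ, g ^ p ^ k ∈ N)
    (P : Ideal (CompletedGroupAlgebra E G)) [P.IsPrime] {g : G} {n : ℕ} (hn : n ≠ 0)
    (hg : of E (g ^ n) - 1 ∈ P) : of E g - 1 ∈ P := by
  -- The `p`-part of `n` is a Frobenius power, removed by primality. For the part `m` prime to `p`,
  -- the cofactor `1 + g + ⋯ + g ^ (m - 1)` has augmentation `m ≠ 0` and cannot lie in `P`.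
  obtain ⟨s, m, hm, rfl⟩ := Nat.exists_eq_pow_mul_and_not_dvd hn p hp.out.ne_one
  rw [mul_comm, pow_mul, ← of_sub_one_pow] at hg
  have h1 := Ideal.IsPrime.mem_of_pow_mem inferInstance _ hg
  rw [map_pow, ← mul_geom_sum] at h1
  refine (Ideal.IsPrime.mem_or_mem inferInstance h1).resolve_right fun h2 => ?_
  have h3 := augmentation_eq_zero_of_mem hG (Ideal.IsPrime.ne_top inferInstance) h2
  rw [map_sum] at h3
  simp only [map_pow, augmentation_of, one_pow, Finset.sum_const, Finset.card_range,
    nsmul_eq_mul, mul_one] at h3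
  exact hm ((CharP.cast_eq_zero_iff E p m).1 h3)

end CompletedGroupAlgebra
end

/-! ### Finite differences, and the arithmetic of `𝒪_F`, `U` and `Γ`. -/

noncomputable section

open Polynomial in
/-- Differencing a polynomial function with values in a subring, down to degree one. -/
theorem Subring.mem_of_forall_aeval_mem {O : Type*} [CommRing O] (S : Subring O)
    (hdiv : ∀ (n : ℤ) (x : O), n ≠ 0 → n • x ∈ S → x ∈ S) (c : ℤ) (hc : c ≠ 0) (Y : Set O)
    (hY : ∀ y ∈ Y, y + c ∈ Y) (n : ℕ) (f : ℤ[X]) (hf : f.natDegree = n + 1)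
    (hfY : ∀ y ∈ Y, aeval y f ∈ S) : ∀ y ∈ Y, y ∈ S := by
  induction n generalizing f with
  | zero =>
    intro y hy
    have h1 := hfY y hy
    have hlc : f.coeff 1 ≠ 0 := by
      have h2 : f.leadingCoeff ≠ 0 := leadingCoeff_ne_zero.2 (by
        rintro rfl
        simp at hf)
      rwa [leadingCoeff, hf] at h2
    rw [f.eq_X_add_C_of_natDegree_le_one (by omega)] at h1
    simp only [map_add, map_mul, aeval_C, aeval_X] at h1
    refine hdiv _ y hlc ?_
    rw [zsmul_eq_mul]
    have h3 : algebraMap ℤ O (f.coeff 0) ∈ S := by simp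
    simpa using S.sub_mem h1 h3
  | succ n ih =>
    have hlc : f.coeff (n + 2) ≠ 0 := by
      have h2 : f.leadingCoeff ≠ 0 := leadingCoeff_ne_zero.2 (by
        rintro rfl
        simp at hf)
      rwa [leadingCoeff, hf] at h2
    -- The coefficient of `f (X + c)` in degree `n + 1` is the Hasse derivative of that order
    -- evaluated at `c`; it is linear since `f` has degree `n + 2`.
    have hcoeff : (taylor c f - f).coeff (n + 1) = (n + 2) * f.coeff (n + 2) * c := by
      rw [coeff_sub, taylor_coeff]
      have hd : (hasseDeriv (n + 1) f).natDegree ≤ 1 := by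
        refine (natDegree_hasseDeriv_le f (n + 1)).trans ?_
        omega
      rw [(hasseDeriv (n + 1) f).eq_X_add_C_of_natDegree_le_one hd]
      simp [hasseDeriv_coeff, add_comm 1 (n + 1)]
      exact Or.inl (Or.inl (by ring))
    have hne : (taylor c f - f).coeff (n + 1) ≠ 0 := by
      rw [hcoeff]
      exact mul_ne_zero (mul_ne_zero (by positivity) hlc) hc
    refine ih (taylor c f - f) (le_antisymm ?_ (le_natDegree_of_ne_zero hne)) fun y hy => ?_
    · rw [← Nat.lt_succ_iff]
      have hf0 : f ≠ 0 := by
        rintro rfl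
        simp at hlc
      have hdeg : (taylor c f - f).degree < f.degree := by
        rw [← degree_taylor f c]
        refine degree_sub_lt_left (by simp) (by simpa using hf0) (by simp)
      rw [Nat.succ_eq_add_one, ← hf]
      exact natDegree_lt_natDegree (fun h0 => hne (by rw [h0, coeff_zero])) hdeg
    · rw [map_sub, taylor_apply, aeval_comp]
      refine S.sub_mem ?_ (hfY y hy)
      simpa using hfY _ (hY y hy)

section

variable (p : ℕ) [Fact p.Prime] (F : Type*) [NormedField F] [NormedAlgebra ℚ_[p] F]
  [IsUltrametricDist F]

include p in
omit [IsUltrametricDist F] in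
theorem natCast_prime_ne_zero : (p : F) ≠ 0 := by
  intro h
  have := norm_natCast_prime p F
  rw [h, norm_zero, eq_comm, inv_eq_zero, Nat.cast_eq_zero] at this
  exact (Fact.out : p.Prime).ne_zero this

/-- Divisibility by `p ^ n` in the ring of integers is read off from the norm. -/
theorem exists_eq_pow_mul_iff (n : ℕ) (x : integers F) :
    (∃ b : integers F, x = (p : integers F) ^ n * b) ↔ ‖(x : F)‖ ≤ (p : ℝ)⁻¹ ^ n := by
  have hp0 := natCast_prime_ne_zero p F
  have hp : (0 : ℝ) < (p : ℝ)⁻¹ ^ n := by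
    have := (Fact.out : p.Prime).pos
    positivity
  have hpn : ‖(p : F) ^ n‖ = (p : ℝ)⁻¹ ^ n := by rw [norm_pow, norm_natCast_prime p F]
  constructor
  · rintro ⟨b, rfl⟩
    push_cast
    rw [norm_mul, hpn]
    exact mul_le_of_le_one_right hp.le (mem_integers.1 b.2)
  · intro h
    refine ⟨⟨(x : F) / (p : F) ^ n, mem_integers.2 ?_⟩, Subtype.ext ?_⟩
    · rw [norm_div, hpn]
      exact div_le_one_of_le₀ h hp.le
    · push_cast
      rw [mul_div_cancel₀ _ (pow_ne_zero n hp0)]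

theorem prime_inv_lt_one : (p : ℝ)⁻¹ < 1 :=
  inv_lt_one_of_one_lt₀ (by exact_mod_cast (Fact.out : p.Prime).one_lt)

namespace unipotentSubgroup

variable {F} in
theorem ofInteger_apply (b : integers F) :
    ((ofInteger F b : GL (Fin 2) F) : Matrix (Fin 2) (Fin 2) F) 0 1 = b :=
  rfl

variable {F} in
theorem ofInteger_injective : Function.Injective (ofInteger F) := by
  intro b c h
  apply Subtype.ext
  rw [← ofInteger_apply b, h, ofInteger_apply]

theorem ofInteger_neg (b : integers F) : ofInteger F (-b) = (ofInteger F b)⁻¹ := by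
  rw [eq_inv_iff_mul_eq_one, ← ofInteger_add, neg_add_cancel, ofInteger_zero]

/-- The open subgroup `(1 p ^ n 𝒪_F; 0 1)` of `U`. -/
def congruenceSubgroup (n : ℕ) : OpenSubgroup (unipotentSubgroup F) where
  carrier := {u | ∃ b, u = ofInteger F ((p : integers F) ^ n * b)}
  one_mem' := ⟨0, by rw [mul_zero, ofInteger_zero]⟩
  mul_mem' := by
    rintro _ _ ⟨b, rfl⟩ ⟨c, rfl⟩
    exact ⟨b + c, by rw [mul_add, ofInteger_add]⟩
  inv_mem' := by
    rintro _ ⟨b, rfl⟩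
    exact ⟨-b, by rw [mul_neg, ofInteger_neg]⟩
  isOpen' := by
    have hset : {u | ∃ b, u = ofInteger F ((p : integers F) ^ n * b)} =
        (fun u : unipotentSubgroup F =>
          ((u : GL (Fin 2) F) : Matrix (Fin 2) (Fin 2) F) 0 1) ⁻¹'
            Metric.closedBall 0 ((p : ℝ)⁻¹ ^ n) := by
      ext u
      obtain ⟨x, rfl⟩ := ofInteger_surjective F u
      simp only [Set.mem_preimage, mem_closedBall_zero_iff, ofInteger_apply,
        ← exists_eq_pow_mul_iff p F]
      exact exists_congr fun b => ofInteger_injective.eq_iff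
    change IsOpen {u | ∃ b, u = ofInteger F ((p : integers F) ^ n * b)}
    rw [hset]
    refine (IsUltrametricDist.isOpen_closedBall _ ?_).preimage ?_
    · have := (Fact.out : p.Prime).pos
      positivity
    · have hc : Continuous fun u : unipotentSubgroup F =>
          ((u : GL (Fin 2) F) : Matrix (Fin 2) (Fin 2) F) :=
        Units.continuous_val.comp continuous_subtype_val
      exact hc.matrix_elem 0 1

theorem mem_congruenceSubgroup {n : ℕ} {u : unipotentSubgroup F} :
    u ∈ congruenceSubgroup p F n ↔ ∃ b, u = ofInteger F ((p : integers F) ^ n * b) :=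
  Iff.rfl

theorem ofInteger_mem_congruenceSubgroup {n : ℕ} {x : integers F} :
    ofInteger F x ∈ congruenceSubgroup p F n ↔ ‖(x : F)‖ ≤ (p : ℝ)⁻¹ ^ n := by
  rw [mem_congruenceSubgroup, ← exists_eq_pow_mul_iff p F]
  exact exists_congr fun b => ofInteger_injective.eq_iff

theorem ofInteger_pow (n : ℕ) (b : integers F) :
    ofInteger F b ^ n = ofInteger F ((n : integers F) * b) := by
  rw [← ofInteger_nsmul, nsmul_eq_mul]

instance : Nontrivial (unipotentSubgroup F) :=
  ⟨ofInteger F 1, ofInteger F 0, fun h => one_ne_zero (ofInteger_injective h)⟩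

variable [FiniteDimensional ℚ_[p] F]

include p in
theorem isCompact_integers : IsCompact (integers F : Set F) := by
  have : ProperSpace F := FiniteDimensional.proper ℚ_[p] F
  have h : (integers F : Set F) = Metric.closedBall 0 1 := by
    ext x
    rw [mem_closedBall_zero_iff]
    exact mem_integers
  rw [h]
  exact isCompact_closedBall 0 1

include p in
theorem compactSpace : CompactSpace (unipotentSubgroup F) := by
  have : CompactSpace (integers F) := isCompact_iff_compactSpace.1 (isCompact_integers p F)
  exact (ofInteger_surjective F).compactSpace (continuous_ofInteger F)

/-- Finitely many elements generate `𝒪_F` modulo `p`. -/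
theorem exists_finite_generators : ∃ S : Set (integers F), S.Finite ∧
    ∀ x : integers F, ∃ s ∈ S, ∃ b, x = s + (p : integers F) * b := by
  have : CompactSpace (integers F) := isCompact_iff_compactSpace.1 (isCompact_integers p F)
  have hp : (0 : ℝ) < (p : ℝ)⁻¹ := by
    have := (Fact.out : p.Prime).pos
    positivity
  obtain ⟨S, -, hS, hcov⟩ := (isCompact_univ (X := integers F)).finite_cover_balls hp
  refine ⟨S, hS, fun x => ?_⟩
  obtain ⟨s, hs, hxs⟩ := Set.mem_iUnion₂.1 (hcov (Set.mem_univ x))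
  rw [Metric.mem_ball, Subtype.dist_eq, dist_eq_norm] at hxs
  obtain ⟨b, hb⟩ := (exists_eq_pow_mul_iff p F 1 (x - s)).2 (by
    rw [pow_one]
    exact hxs.le)
  refine ⟨s, hs, b, ?_⟩
  rw [pow_one] at hb
  rw [← hb, add_sub_cancel]

/-- Finitely many representatives of `𝒪_F` modulo `p` serve at every level, since multiplying them
by `p ^ n` represents `p ^ n 𝒪_F` modulo `p ^ (n + 1)`. -/
theorem exists_isPowerFiltration : ∃ S : Set (integers F), Finite S ∧
    CompletedGroupAlgebra.IsPowerFiltration p (fun s : S => ofInteger F s)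
      (congruenceSubgroup p F) := by
  obtain ⟨S, hS, hgen⟩ := exists_finite_generators p F
  have hp0 : (0 : ℝ) < (p : ℝ)⁻¹ := by
    have := (Fact.out : p.Prime).pos
    positivity
  refine ⟨S, hS, ?_, ?_, ?_, ?_, ?_⟩
  · refine antitone_nat_of_succ_le fun n => ?_
    rintro _ ⟨b, rfl⟩
    exact ⟨p * b, by rw [pow_succ, mul_assoc]⟩
  · refine top_le_iff.1 fun u _ => ?_
    obtain ⟨x, rfl⟩ := ofInteger_surjective F u
    exact ⟨x, by rw [pow_zero, one_mul]⟩
  · intro N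
    have h1 : (ofInteger F) ⁻¹' (N : Set (unipotentSubgroup F)) ∈ nhds (0 : integers F) :=
      (continuous_ofInteger F).continuousAt.preimage_mem_nhds
        (N.isOpen.mem_nhds (by rw [ofInteger_zero]; exact N.one_mem))
    obtain ⟨ε, hε, hball⟩ := Metric.mem_nhds_iff.1 h1
    obtain ⟨n, hn⟩ := exists_pow_lt_of_lt_one hε (prime_inv_lt_one p)
    refine ⟨n, fun u hu => ?_⟩
    obtain ⟨x, rfl⟩ := ofInteger_surjective F u
    refine hball ?_
    rw [Metric.mem_ball, Subtype.dist_eq, dist_eq_norm]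
    simpa using lt_of_le_of_lt ((ofInteger_mem_congruenceSubgroup p F).1 hu) hn
  · intro s n
    exact ⟨s, by rw [ofInteger_pow, Nat.cast_pow]⟩
  · rintro n _ ⟨b, rfl⟩
    obtain ⟨s, hs, c, rfl⟩ := hgen b
    refine Subgroup.mem_sup.2 ⟨ofInteger F (p ^ n * s),
      Subgroup.subset_closure ⟨⟨s, hs⟩, ?_⟩, ofInteger F (p ^ (n + 1) * c), ⟨c, rfl⟩, ?_⟩
    · simp only [ofInteger_pow, Nat.cast_pow]
    · rw [← ofInteger_add]
      congr 1
      ring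

end unipotentSubgroup

namespace gammaSubgroup

open unipotentSubgroup

variable {p F}

/-- The entry `1 + p a` of the matrix `(1 + p a 0; 0 1)`. -/
def entry (γ : gammaSubgroup p F) : integers F :=
  ⟨((γ : GL (Fin 2) F) : Matrix (Fin 2) (Fin 2) F) 0 0, by
    obtain ⟨γ, a, ha, hγ⟩ := γ
    simp only [hγ]
    exact add_mem (one_mem _) (mul_mem (natCast_mem _ p) ha)⟩

theorem coe_eq_entry (γ : gammaSubgroup p F) :
    ((γ : GL (Fin 2) F) : Matrix (Fin 2) (Fin 2) F) = !![(entry γ : F), 0; 0, 1] := by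
  obtain ⟨γ, a, ha, hγ⟩ := γ
  simp [entry, hγ]

theorem exists_entry_eq (a : integers F) : ∃ γ : gammaSubgroup p F, entry γ = 1 + p * a := by
  have hn := norm_one_add_prime_mul p F a.2
  have h0 : 1 + (p : F) * a ≠ 0 := by
    intro h
    rw [h, norm_zero] at hn
    exact zero_ne_one hn
  refine ⟨⟨Matrix.GeneralLinearGroup.mkOfDetNeZero !![1 + (p : F) * a, 0; 0, 1] ?_, a, a.2, rfl⟩, ?_⟩
  · simpa [Matrix.det_fin_two] using h0
  · apply Subtype.ext
    simp [entry, Matrix.GeneralLinearGroup.mkOfDetNeZero]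

theorem entry_one : entry (1 : gammaSubgroup p F) = 1 :=
  Subtype.ext (by simp [entry])

theorem entry_mul (γ δ : gammaSubgroup p F) : entry (γ * δ) = entry γ * entry δ := by
  apply Subtype.ext
  change ((γ : GL (Fin 2) F) * (δ : GL (Fin 2) F) : Matrix (Fin 2) (Fin 2) F) 0 0 = _
  rw [coe_eq_entry, coe_eq_entry]
  simp

theorem entry_pow (γ : gammaSubgroup p F) (n : ℕ) : entry (γ ^ n) = entry γ ^ n := by
  induction n with
  | zero => simp [entry_one]
  | succ n ih => rw [pow_succ, pow_succ, entry_mul, ih]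

theorem smul_ofInteger (γ : gammaSubgroup p F) (b : integers F) :
    γ • ofInteger F b = ofInteger F (entry γ * b) := by
  apply Subtype.ext
  rw [gammaSubgroup_coe_smul, mul_inv_eq_iff_eq_mul]
  apply Units.ext
  rw [Units.val_mul, Units.val_mul, coe_eq_entry]
  simp [ofInteger]

end gammaSubgroup

end

end

/-! ### Primes of `E[[U]]` stable under powers of elements of `Γ`. -/

noncomputable section

open unipotentSubgroup CompletedGroupAlgebra

section

variable {p : ℕ} [Fact p.Prime] {F : Type*} [NormedField F] [NormedAlgebra ℚ_[p] F]
  [IsUltrametricDist F] {E : Type*} [Field E]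

/-- `p`-adic integers sufficiently close to `1` are `r`-th powers of elements of `Γ`. -/
theorem gammaSubgroup.exists_entry_pow_eq {r : ℕ} (hr : r ≠ 0) :
    ∃ K : ℕ, ∀ m : ℕ, ∃ γ : gammaSubgroup p F,
      gammaSubgroup.entry (γ ^ r) = ((1 + p ^ K * m : ℕ) : integers F) := by
  have hr0 : 0 < ‖(r : ℤ_[p])‖ ^ 2 := by
    have : (r : ℤ_[p]) ≠ 0 := by exact_mod_cast hr
    positivity
  -- This is the hypothesis of Hensel's lemma for `X ^ r - (1 + p ^ K m)` at `1`, where the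
  -- derivative is `r`.
  obtain ⟨K, hK⟩ := exists_pow_lt_of_lt_one hr0 (prime_inv_lt_one p)
  refine ⟨K, fun m => ?_⟩
  obtain ⟨z, hz, hz1, -⟩ := hensels_lemma (p := p)
    (F := (Polynomial.X ^ r - ((1 + p ^ K * m : ℕ) : Polynomial ℤ_[p]))) (a := 1) (by
      simp only [map_sub, map_pow, Polynomial.aeval_X, one_pow, Polynomial.derivative_X_pow,
        Polynomial.derivative_natCast, map_mul, sub_zero, mul_one, map_natCast]
      refine lt_of_le_of_lt ?_ hK
      push_cast
      rw [sub_add_cancel_left, norm_neg, norm_mul, norm_pow, PadicInt.norm_p]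
      exact mul_le_of_le_one_right (by positivity) (PadicInt.norm_le_one _))
  simp only [map_sub, map_pow, Polynomial.aeval_X, sub_eq_zero, Polynomial.derivative_X_pow,
    Polynomial.derivative_natCast, map_mul, one_pow, sub_zero, mul_one,
    map_natCast] at hz hz1
  -- The root satisfies `‖z - 1‖ < ‖r‖ ≤ 1`, hence has the form `1 + p a` of an entry of `Γ`.
  obtain ⟨a, ha⟩ := (PadicInt.norm_lt_one_iff_dvd _).1
    (lt_of_lt_of_le hz1 (PadicInt.norm_le_one _))
  have haF : algebraMap ℚ_[p] F a ∈ integers F := by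
    rw [mem_integers, norm_algebraMap']
    exact a.2
  obtain ⟨γ, hγ⟩ := gammaSubgroup.exists_entry_eq (p := p) (⟨_, haF⟩ : integers F)
  refine ⟨γ, ?_⟩
  rw [gammaSubgroup.entry_pow, hγ]
  apply Subtype.ext
  rw [sub_eq_iff_eq_add'.1 ha] at hz
  have := congrArg (fun x : ℤ_[p] => algebraMap ℚ_[p] F x) hz
  push_cast at this ⊢
  simpa using this

theorem smul_of_ofInteger (γ : gammaSubgroup p F) (b : integers F) :
    γ • of E (ofInteger F b) = of E (ofInteger F (gammaSubgroup.entry γ * b)) := by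
  rw [smul_def, map_of, MulDistribMulAction.toMonoidHom_apply, gammaSubgroup.smul_ofInteger]

theorem proj_smul_eq_zero (γ : gammaSubgroup p F) (n : ℕ)
    (x : CompletedGroupAlgebra E (unipotentSubgroup F))
    (hx : proj E (congruenceSubgroup p F n) x = 0) :
    proj E (congruenceSubgroup p F n) (γ • x) = 0 := by
  rw [smul_def, proj_map]
  refine (congrArg _ (proj_eq_zero_of_le ?_ hx)).trans (map_zero _)
  rintro _ ⟨b, rfl⟩
  refine ⟨gammaSubgroup.entry γ * b, ?_⟩
  rw [MulDistribMulAction.toMonoidHom_apply, gammaSubgroup.smul_ofInteger]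
  congr 1
  ring

variable [CharP E p]

theorem mem_iwasawaMaximalIdeal_of_augmentation
    {x : CompletedGroupAlgebra E (unipotentSubgroup F)} (hx : augmentation E _ x = 0) :
    x ∈ iwasawaMaximalIdeal p F E := by
  have := iwasawaAlgebra_isLocalRing p F E
  refine (IsLocalRing.mem_maximalIdeal x).2 fun hu => ?_
  exact (hu.map (augmentation E _)).ne_zero hx

theorem augmentation_eq_zero_of_mem_iwasawaMaximalIdeal
    {x : CompletedGroupAlgebra E (unipotentSubgroup F)} (hx : x ∈ iwasawaMaximalIdeal p F E) :
    augmentation E _ x = 0 := by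
  have := iwasawaAlgebra_isLocalRing p F E
  refine augmentation_eq_zero_of_mem (unipotentSubgroup_pow_mem p F) ?_ hx
  exact (IsLocalRing.maximalIdeal.isMaximal _).ne_top

/-- If a prime `P` of `E[[U]]` is stable under the `r`-th powers of elements of `Γ`, then `U` acts
faithfully on `E[[U]]/P` or trivially. -/
theorem faithful_or_trivial (P : Ideal (CompletedGroupAlgebra E (unipotentSubgroup F))) [P.IsPrime]
    {r : ℕ} (hr : r ≠ 0) (hP : ∀ γ : gammaSubgroup p F, ∀ x ∈ P, γ ^ r • x ∈ P) :
    (∀ u : unipotentSubgroup F, of E u - 1 ∈ P → u = 1) ∨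
      ∀ u : unipotentSubgroup F, of E u - 1 ∈ P := by
  have hG := unipotentSubgroup_pow_mem p F
  let L : Set (integers F) := {b | of E (ofInteger F b) - 1 ∈ P}
  have hLadd : ∀ b ∈ L, ∀ c ∈ L, b + c ∈ L := by
    intro b hb c hc
    have : of E (ofInteger F (b + c)) - 1 =
        of E (ofInteger F b) * (of E (ofInteger F c) - 1) + (of E (ofInteger F b) - 1) := by
      rw [ofInteger_add, map_mul]
      ring
    change of E (ofInteger F (b + c)) - 1 ∈ P
    rw [this]
    exact P.add_mem (P.mul_mem_left _ hc) hb
  have hLneg : ∀ b ∈ L, -b ∈ L := by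
    intro b hb
    have : of E (ofInteger F (-b)) - 1 = -(of E (ofInteger F (-b)) * (of E (ofInteger F b) - 1)) := by
      rw [mul_sub, ← map_mul, ← ofInteger_add, neg_add_cancel, ofInteger_zero, map_one]
      ring
    change of E (ofInteger F (-b)) - 1 ∈ P
    rw [this]
    exact P.neg_mem (P.mul_mem_left _ hb)
  have hL0 : (0 : integers F) ∈ L := by
    change of E (ofInteger F 0) - 1 ∈ P
    rw [ofInteger_zero, map_one, sub_self]
    exact P.zero_mem
  have hLdiv : ∀ (n : ℕ) b, n ≠ 0 → (n : integers F) * b ∈ L → b ∈ L := by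
    intro n b hn hb
    refine of_sub_one_mem_of_pow hG P hn ?_
    rw [ofInteger_pow]
    exact hb
  have hLγ : ∀ γ : gammaSubgroup p F, ∀ b ∈ L, gammaSubgroup.entry γ ^ r * b ∈ L := by
    intro γ b hb
    have := hP γ _ hb
    rwa [smul_sub, smul_one, smul_of_ofInteger, gammaSubgroup.entry_pow] at this
  -- the multipliers of `L` exhaust `𝒪_F`
  let S : Subring (integers F) :=
    { carrier := {x | ∀ b ∈ L, x * b ∈ L}
      one_mem' := fun b hb => by rwa [one_mul]
      zero_mem' := fun b _ => by rwa [zero_mul]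
      mul_mem' := fun {x y} hx hy b hb => by
        rw [mul_assoc]
        exact hx _ (hy b hb)
      add_mem' := fun {x y} hx hy b hb => by
        rw [add_mul]
        exact hLadd _ (hx b hb) _ (hy b hb)
      neg_mem' := fun {x} hx b hb => by
        rw [neg_mul]
        exact hLneg _ (hx b hb) }
  have hSdivn : ∀ (n : ℕ) (x : integers F), n ≠ 0 → n • x ∈ S → x ∈ S := by
    intro n x hn hx b hb
    refine hLdiv n _ hn ?_
    rw [← mul_assoc, ← nsmul_eq_mul]
    exact hx b hb
  have hSdiv : ∀ (n : ℤ) (x : integers F), n ≠ 0 → n • x ∈ S → x ∈ S := by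
    intro n x hn hx
    refine hSdivn n.natAbs x (Int.natAbs_ne_zero.2 hn) ?_
    rcases Int.natAbs_eq n with h | h
    · rw [h, natCast_zsmul] at hx
      exact hx
    · rw [h, neg_smul, natCast_zsmul] at hx
      simpa using S.neg_mem hx
  have hp0 : (p : ℤ) ≠ 0 := by exact_mod_cast (Fact.out : p.Prime).ne_zero
  -- The polynomial `X ^ r` maps `1 + p 𝒪_F`, which is stable under translation by `p`, into `S`.
  -- Differencing gives `1 + p 𝒪_F ⊆ S`; subtracting `1` and dividing by `p` gives everything.
  have hS : ∀ x, x ∈ S := by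
    intro a
    obtain ⟨s, rfl⟩ := Nat.exists_eq_succ_of_ne_zero hr
    have hY := S.mem_of_forall_aeval_mem hSdiv p hp0
      {y | ∃ b : integers F, y = 1 + (p : integers F) * b} (by
        rintro _ ⟨b, rfl⟩
        exact ⟨b + 1, by push_cast; ring⟩) s (Polynomial.X ^ (s + 1)) (by simp) (by
        rintro _ ⟨b, rfl⟩
        obtain ⟨γ, hγ⟩ := gammaSubgroup.exists_entry_eq (p := p) b
        rw [map_pow, Polynomial.aeval_X, ← hγ]
        exact hLγ γ) (1 + p * a) ⟨a, rfl⟩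
    have h2 := S.sub_mem hY S.one_mem
    rw [add_sub_cancel_left] at h2
    exact hSdiv p a hp0 (by rwa [zsmul_eq_mul, Int.cast_natCast])
  by_cases hL : ∀ b ∈ L, b = 0
  · left
    intro u hu
    obtain ⟨b, rfl⟩ := ofInteger_surjective F u
    rw [hL b hu, ofInteger_zero]
  · right
    push Not at hL
    obtain ⟨b, hb, hb0⟩ := hL
    intro u
    obtain ⟨x, rfl⟩ := ofInteger_surjective F u
    have hbF : 0 < ‖(b : F)‖ := norm_pos_iff.2 fun h => hb0 (Subtype.ext h)
    obtain ⟨n, hn⟩ := exists_pow_lt_of_lt_one hbF (prime_inv_lt_one p)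
    have hc : (p : F) ^ n / b ∈ integers F := by
      rw [mem_integers, norm_div, norm_pow, norm_natCast_prime p F]
      exact div_le_one_of_le₀ hn.le hbF.le
    -- A nonzero `𝒪_F`-submodule contains a power of `p`; closure under division then puts `1` in
    -- `L`.
    have h1 : ((p ^ n : ℕ) : integers F) * 1 ∈ L := by
      have := hS ⟨_, hc⟩ b hb
      convert this using 1
      apply Subtype.ext
      push_cast
      rw [mul_one, div_mul_cancel₀ _ (norm_pos_iff.1 hbF)]
    have h2 := hS x 1 (hLdiv _ _ (pow_ne_zero n (Fact.out : p.Prime).ne_zero) h1)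
    rwa [mul_one] at h2

variable [FiniteDimensional ℚ_[p] F]

theorem eq_bot_or_eq_iwasawaMaximalIdeal
    (P : Ideal (CompletedGroupAlgebra E (unipotentSubgroup F))) [P.IsPrime]
    {r : ℕ} (hr : r ≠ 0) (hP : ∀ γ : gammaSubgroup p F, ∀ x ∈ P, γ ^ r • x ∈ P) :
    P = ⊥ ∨ P = iwasawaMaximalIdeal p F E := by
  have hG := unipotentSubgroup_pow_mem p F
  have := compactSpace p F
  obtain ⟨S, _, hS⟩ := exists_isPowerFiltration p F
  rcases faithful_or_trivial P hr hP with hfaith | htriv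
  · left
    -- Conjugation by a suitable `γ ^ r` is exactly raising to the power `1 + p ^ K m` on `U`.
    obtain ⟨K, hK⟩ := gammaSubgroup.exists_entry_pow_eq (p := p) (F := F) hr
    choose γ hγ using hK
    refine eq_bot_of_faithful (K := K) hS hG P hfaith
      (Φ := fun m => map E (MulDistribMulAction.toMonoidHom (unipotentSubgroup F) (γ m ^ r))
        (continuous_toMonoidHom (γ m ^ r))) ?_ ?_ ?_
    · intro m u
      obtain ⟨b, rfl⟩ := ofInteger_surjective F u
      rw [← smul_def, smul_of_ofInteger, hγ, ← map_pow, ofInteger_pow]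
    · intro m n x hx
      exact proj_smul_eq_zero _ n x hx
    · intro m x hx
      exact hP _ x hx
  · right
    refine le_antisymm (fun x hx => ?_) fun x hx => ?_
    · exact mem_iwasawaMaximalIdeal_of_augmentation
        (augmentation_eq_zero_of_mem hG (Ideal.IsPrime.ne_top inferInstance) hx)
    · have h1 := mem_span_of_augmentation_eq_zero hS x
        (augmentation_eq_zero_of_mem_iwasawaMaximalIdeal hx)
      refine Ideal.span_le.2 ?_ h1
      rintro _ ⟨s, rfl⟩
      exact htriv _

end

end

/-! ### Associated primes and the conclusion. -/

section

open unipotentSubgroup CompletedGroupAlgebra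

/-- A finitely generated module over a Noetherian ring all of whose associated primes are maximal
has finite length. -/
theorem isFiniteLength_of_associatedPrimes_isMaximal {R M : Type*} [CommRing R] [IsNoetherianRing R]
    [AddCommGroup M] [Module R M] [Module.Finite R M]
    (h : ∀ P ∈ associatedPrimes R M, P.IsMaximal) : IsFiniteLength R M := by
  let I := Module.annihilator R M
  -- Minimal primes over the annihilator are associated, hence maximal, so every prime over it is
  -- maximal and `R ⧸ I` is Artinian.
  have hdim : Ring.KrullDimLE 0 (R ⧸ I) := by
    rw [Ring.krullDimLE_zero_iff]
    intro Q hQ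
    have hIQ : I ≤ Q.comap (Ideal.Quotient.mk I) := by
      exact (Ideal.mk_ker (I := I)).ge.trans (Ideal.ker_le_comap _)
    have := Ideal.comap_isPrime (Ideal.Quotient.mk I) Q
    obtain ⟨P, hP, hPQ⟩ := Ideal.exists_minimalPrimes_le hIQ
    have hmax := h P (Module.associatedPrimes.minimalPrimes_annihilator_subset_associatedPrimes R M hP)
    have heq := hmax.eq_of_le this.ne_top hPQ
    exact Ideal.isMaximal_of_isIntegral_of_isMaximal_comap' (Ideal.Quotient.mk I)
      (RingHom.isIntegral_of_surjective _ Ideal.Quotient.mk_surjective) Q (heq ▸ hmax)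
  have hart : IsArtinianRing (R ⧸ I) :=
    isArtinianRing_iff_isNoetherianRing_krullDimLE_zero.2 ⟨inferInstance, hdim⟩
  let _ : Module (R ⧸ I) M := Module.IsTorsionBySet.module (Module.isTorsionBySet_annihilator R M)
  have : IsScalarTower R (R ⧸ I) M :=
    Module.IsTorsionBySet.isScalarTower (Module.isTorsionBySet_annihilator R M)
  have : Module.Finite (R ⧸ I) M := Module.Finite.of_restrictScalars_finite R (R ⧸ I) M
  have : IsArtinian (R ⧸ I) M := inferInstance
  exact isFiniteLength_iff_isNoetherian_isArtinian.2 ⟨inferInstance,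
    isArtinian_of_surjective_algebraMap (R := R ⧸ I) Ideal.Quotient.mk_surjective⟩

open scoped Pointwise in
/-- If a group acts semilinearly on a finitely generated module over a Noetherian ring, some
power of each group element fixes all the associated primes. -/
theorem exists_pow_smul_mem_of_mem_associatedPrimes {R M Δ : Type*} [CommRing R]
    [IsNoetherianRing R] [AddCommGroup M] [Module R M] [Module.Finite R M] [Group Δ]
    [MulSemiringAction Δ R] [DistribMulAction Δ M]
    (hsl : ∀ (γ : Δ) (a : R) (m : M), γ • (a • m) = (γ • a) • (γ • m)) :
    ∃ r : ℕ, r ≠ 0 ∧ ∀ P ∈ associatedPrimes R M, ∀ γ : Δ, ∀ x ∈ P, γ ^ r • x ∈ P := by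
  let A : SubMulAction Δ (Ideal R) :=
    { carrier := associatedPrimes R M
      smul_mem' := by
        intro γ P hP
        rw [AssociatedPrimes.mem_iff, isAssociatedPrime_iff] at hP ⊢
        obtain ⟨hP, x, hx⟩ := hP
        refine ⟨inferInstance, γ • x, ?_⟩
        ext a
        rw [Ideal.mem_pointwise_smul_iff_inv_smul_mem, hx, Submodule.mem_colon_singleton,
          Submodule.mem_colon_singleton, Submodule.mem_bot, Submodule.mem_bot,
          ← smul_eq_zero_iff_eq γ, hsl, smul_inv_smul] }
  have hfin : Finite A := associatedPrimes.finite R M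
  -- The order of the permutation group of the finite set of associated primes is an exponent valid
  -- for all `γ` at once.
  refine ⟨Nat.card (Equiv.Perm A), Nat.card_pos.ne', fun P hP γ x hx => ?_⟩
  have h1 : (MulAction.toPermHom Δ A γ) ^ Nat.card (Equiv.Perm A) = 1 := pow_card_eq_one'
  rw [← map_pow] at h1
  have h2 := congrArg (fun e : Equiv.Perm A => ((e ⟨P, hP⟩ : A) : Ideal R)) h1
  have h3 : γ ^ Nat.card (Equiv.Perm A) • P = P := h2
  rw [← h3]
  exact Ideal.smul_mem_pointwise_smul _ _ _ hx

end

theorem mainTheorem3 (p : ℕ) [Fact p.Prime]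
    (F : Type*) [NormedField F] [NormedAlgebra ℚ_[p] F] [FiniteDimensional ℚ_[p] F]
    [IsUltrametricDist F]
    (E : Type*) [Field E] [CharP E p]
    (M : Type*) [AddCommGroup M] [Module (CompletedGroupAlgebra E (unipotentSubgroup F)) M]
    [Module.Finite (CompletedGroupAlgebra E (unipotentSubgroup F)) M]
    [DistribMulAction (gammaSubgroup p F) M]
    (hsemilinear : ∀ (γ : gammaSubgroup p F)
      (a : CompletedGroupAlgebra E (unipotentSubgroup F)) (m : M),
      γ • (a • m) = (γ • a) • (γ • m)) :
    associatedPrimes (CompletedGroupAlgebra E (unipotentSubgroup F)) M ⊆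
        {⊥, iwasawaMaximalIdeal p F E} ∧
      (Module.IsTorsion (CompletedGroupAlgebra E (unipotentSubgroup F)) M →
        associatedPrimes (CompletedGroupAlgebra E (unipotentSubgroup F)) M ⊆
            {iwasawaMaximalIdeal p F E} ∧
          IsFiniteLength (CompletedGroupAlgebra E (unipotentSubgroup F)) M) := by
  have := iwasawaAlgebra_isLocalRing p F E
  have hnoeth : IsNoetherianRing (CompletedGroupAlgebra E (unipotentSubgroup F)) := by
    obtain ⟨S, _, hS⟩ := unipotentSubgroup.exists_isPowerFiltration p F
    exact CompletedGroupAlgebra.isNoetherianRing hS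
  obtain ⟨r, hr, hstab⟩ := exists_pow_smul_mem_of_mem_associatedPrimes hsemilinear
  have hAss : associatedPrimes (CompletedGroupAlgebra E (unipotentSubgroup F)) M ⊆
      {⊥, iwasawaMaximalIdeal p F E} := by
    intro P hP
    have := hP.isPrime
    exact eq_bot_or_eq_iwasawaMaximalIdeal P hr (hstab P hP)
  refine ⟨hAss, fun htors => ?_⟩
  have hAss' : associatedPrimes (CompletedGroupAlgebra E (unipotentSubgroup F)) M ⊆
      {iwasawaMaximalIdeal p F E} := by
    intro P hP
    refine (hAss hP).resolve_left ?_
    rintro rfl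
    rw [AssociatedPrimes.mem_iff, isAssociatedPrime_iff] at hP
    obtain ⟨-, x, hx⟩ := hP
    -- An element with annihilator `0` cannot be killed by a nonzerodivisor of this nontrivial ring.
    obtain ⟨a, ha⟩ := @htors x
    have h0 : (a : CompletedGroupAlgebra E (unipotentSubgroup F)) ∈
        (⊥ : Ideal (CompletedGroupAlgebra E (unipotentSubgroup F))) := by
      rw [hx, Submodule.mem_colon_singleton]
      exact ha
    exact nonZeroDivisors.ne_zero a.2 h0
  refine ⟨hAss', isFiniteLength_of_associatedPrimes_isMaximal fun P hP => ?_⟩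
  rw [hAss' hP]
  exact IsLocalRing.maximalIdeal.isMaximal _
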